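/- **Conventions.** All objects are families indexed by $t$ in an arbitrary index set $\Theta$ (the index is mostly omitted): integers $n=n_t\ge 1$, $p=p_t\ge 0$, a probability space for each $t$, and random matrices on it. For families of reals, $a\le O(b)$ (resp. $a\ge O(b)$) means that there is a constant $C>0$, independent of $t$, with $a_t\le C b_t$ (resp. $a_t\ge C b_t$) for all $t$. $\|\cdot\|$ is the Euclidean norm of vectors and the spectral norm of matrices, $\|\cdot\|_F$ the Frobenius norm; $\mathcal M_{p,n}$ is the space of real $p\times n$ matrices, $\mathcal M_p=\mathcal M_{p,p}$, and $\mathcal D_n$ is the space of real diagonal $n\times n$ matrices. For $M=(m_1,\dots,m_n)\in\mathcal M_{p,n}$, $M_{-i}$ is $M$ with its $i$-th column replaced by $0$; for $\Delta\in\mathcal D_n$, $\Delta_{-i}$ is $\Delta$ with its $i$-th diagonal entry replaced by $0$. *Lipschitz concentration.* $Z\propto\mathcal E_2$ in a normed space $E$ means: there are $C,c>0$, independent of $t$, such that for every $1$-Lipschitz $f:E\to\mathbb R$, $f(Z)$ is integrable and $\mathbb P(|f(Z)-\mathbb E f(Z)|\ge s)\le Ce^{-(s/c)^2}$ for all $s>0$.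 *Linear concentration.* $Z\in\mathcal E_q(\sigma)+\mathcal E_r(\rho)$ in $(E,\|\cdot\|)$ means: there are deterministic $\tilde Z\in E$ (one for each $t$) and $C,c>0$ independent of $t$ such that for every linear form $f$ on $E$ with $|f(x)|\le\|x\|$ for all $x$, and all $s>0$, $$\mathbb P\big(|f(Z)-f(\tilde Z)|\ge s\big)\le C e^{-(s/(c\sigma))^q}+C e^{-(s/(c\rho))^r},$$ where a term with vanishing parameter ($\sigma=0$ or $\rho=0$) is read as its limit $0$. **Theorem.** Let $X=(x_1,\dots,x_n)$, $Y=(y_1,\dots,y_n)\in\mathcal M_{p,n}$ be random matrices and $D\in\mathcal D_n$ a random diagonal matrix, with $p\le O(n)$. Assume: - $(X,D,Y)\propto\mathcal E_2$ in $\mathcal M_{p,n}\times\mathcal D_n\times\mathcal M_{p,n}$ with the norm $\max(\|\cdot\|_F,\|\cdot\|_F,\|\cdot\|_F)$; - the couples $(x_1,y_1),\dots,(x_n,y_n)$ are independent; - $\sup_{i\in[n]}\|\mathbb E[x_i]\|\le O(1)$ and $\sup_{i\in[n]}\|\mathbb E[y_i]\|\le O(1)$; - for all $i\in[n]$ there is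 a random diagonal matrix $D^{(i)}\in\mathcal D_n$ such that $(x_i,y_i)$ is independent of the triple $(X_{-i},Y_{-i},D^{(i)})$, and such that almost surely $\|D_{-i}-D^{(i)}_{-i}\|_F\le K$ for a constant $K$ independent of $i$ and $t$; - there are $\kappa,\kappa_D,\varepsilon>0$ (possibly depending on $t$) with $\kappa,\kappa_D\le O(1)$ and $\varepsilon\ge O(1)$ such that almost surely $\|X\|,\|Y\|\le\sqrt n\,\kappa$ and $\|D\|\le\kappa_D$, and $\kappa^2\kappa_D\le 1-\varepsilon$. Then $I_p-\frac1n XDY^T$ is almost surely invertible, and the resolvent $Q=(I_p-\frac1nXDY^T)^{-1}$ satisfies the linear concentration $$Q\in\mathcal E_1\!\left(\sqrt{\frac{\log n}{n}}\right)+\mathcal E_{1/2}\!\left(\frac1{\sqrt n}\right)\qquad\text{in }(\mathcal M_p,\|\cdot\|).$$ -/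

import Mathlib

open MeasureTheory ProbabilityTheory

noncomputable section

/-- The entrywise (Borel) measurable structure on matrices. -/
instance matrixMeasurableSpace {m n : Type*} : MeasurableSpace (Matrix m n ℝ) :=
  inferInstanceAs (MeasurableSpace (m → n → ℝ))

/-- `a ≤ O(b)` for two families of reals with a common index set: one constant `C > 0` such that
`a t ≤ C * b t` for every index `t`. -/
def LeO {Θ : Type*} (a b : Θ → ℝ) : Prop :=
  ∃ C : ℝ, 0 < C ∧ ∀ t, a t ≤ C * b t

/-- `a ≥ O(b)`: one constant `C > 0` such that `a t ≥ C * b t` for every index `t`. -/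
def GeO {Θ : Type*} (a b : Θ → ℝ) : Prop :=
  ∃ C : ℝ, 0 < C ∧ ∀ t, C * b t ≤ a t

open scoped Matrix.Norms.L2Operator in
/-- The spectral norm of a real matrix (operator norm between Euclidean spaces). -/
def specNorm {m n : ℕ} (A : Matrix (Fin m) (Fin n) ℝ) : ℝ := ‖A‖

open scoped Matrix.Norms.Frobenius in
/-- The Frobenius norm of a real matrix. -/
def frobNorm {m n : ℕ} (A : Matrix (Fin m) (Fin n) ℝ) : ℝ := ‖A‖

/-- The space in which a triple `(X, D, Y)` lives: `X, Y` are `p × n` matrices and `D` is a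
diagonal `n × n` matrix, given by its diagonal. -/
abbrev Triple (p n : ℕ) : Type :=
  Matrix (Fin p) (Fin n) ℝ × (Fin n → ℝ) × Matrix (Fin p) (Fin n) ℝ

/-- The product (maximum) norm on triples, each factor carrying the Frobenius norm. -/
def tripleNorm {p n : ℕ} (z : Triple p n) : ℝ :=
  max (frobNorm z.1) (max (frobNorm (Matrix.diagonal z.2.1)) (frobNorm z.2.2))

/-- The concentration profile of the class `𝓔_q(σ)`, namely `s ↦ exp (-(s / σ)^q)`, with its
limit value `0` when the observable diameter `σ` vanishes. The class `𝓔_q(σ) + 𝓔_r(ρ)` has the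
pointwise sum of the two profiles. -/
def expProfile {Θ : Type*} (q : ℝ) (σ : Θ → ℝ) : Θ → ℝ → ℝ :=
  fun t s => if σ t = 0 then 0 else Real.exp (-(s / σ t) ^ q)

section Concentration

variable {Θ : Type*} {Ω : Θ → Type*} [∀ t, MeasurableSpace (Ω t)]
  {E : Θ → Type*} [∀ t, AddCommGroup (E t)] [∀ t, Module ℝ (E t)]

/-- Lipschitz concentration of a family `Z t` of random vectors of the normed spaces
`(E t, N t)`, with profile `α`: there are `C, c > 0`, the same for all indices, such that
`ℙ(|f(Z) - 𝔼[f(Z)]| ≥ s) ≤ C α(s / c)` for all `s > 0` and all `f : E t → ℝ` which are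
`1`-Lipschitz for `N t`. For `α = expProfile q σ` this is `Z ∝ 𝓔_q(σ)`. -/
def LipschitzConcentrated (μ : ∀ t, Measure (Ω t)) (N : ∀ t, E t → ℝ)
    (Z : ∀ t, Ω t → E t) (α : Θ → ℝ → ℝ) : Prop :=
  ∃ C c : ℝ, 0 < C ∧ 0 < c ∧ ∀ (t : Θ) (f : E t → ℝ), (∀ x y, |f x - f y| ≤ N t (x - y)) →
    Integrable (fun ω => f (Z t ω)) (μ t) ∧
    ∀ s : ℝ, 0 < s →
      (μ t).real {ω | s ≤ |f (Z t ω) - ∫ ω', f (Z t ω') ∂(μ t)|} ≤ C * α t (s / c)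

/-- Linear concentration of a family `Z t` of random vectors of the normed spaces `(E t, N t)`
around the deterministic equivalent `Z₀`, with profile `α`: there are `C, c > 0`, the same for all
indices, such that `ℙ(|f(Z) - f(Z₀)| ≥ s) ≤ C α(s / c)` for all `s > 0` and all linear forms `f`
with `|f x| ≤ N t x`. For `α = expProfile q σ` this is `Z ∈ Z₀ ± 𝓔_q(σ)`. -/
def LinearlyConcentratedAround (μ : ∀ t, Measure (Ω t)) (N : ∀ t, E t → ℝ)
    (Z : ∀ t, Ω t → E t) (Z₀ : ∀ t, E t) (α : Θ → ℝ → ℝ) : Prop :=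
  ∃ C c : ℝ, 0 < C ∧ 0 < c ∧ ∀ (t : Θ) (f : E t →ₗ[ℝ] ℝ), (∀ x, |f x| ≤ N t x) →
    ∀ s : ℝ, 0 < s →
      (μ t).real {ω | s ≤ |f (Z t ω) - f (Z₀ t)|} ≤ C * α t (s / c)

/-- Linear concentration around some deterministic equivalent; for `α = expProfile q σ` this is
`Z ∈ 𝓔_q(σ)`. -/
def LinearlyConcentrated (μ : ∀ t, Measure (Ω t)) (N : ∀ t, E t → ℝ)
    (Z : ∀ t, Ω t → E t) (α : Θ → ℝ → ℝ) : Prop :=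
  ∃ Z₀ : ∀ t, E t, LinearlyConcentratedAround μ N Z Z₀ α

end Concentration

/-- The matrix `I_p - X D Yᵀ / n`, with `D` given by its diagonal. -/
def resolventInv {p n : ℕ} (X : Matrix (Fin p) (Fin n) ℝ) (D : Fin n → ℝ)
    (Y : Matrix (Fin p) (Fin n) ℝ) : Matrix (Fin p) (Fin p) ℝ :=
  1 - (1 / (n : ℝ)) • (X * Matrix.diagonal D * Y.transpose)

/-- The resolvent `Q = (I_p - X D Yᵀ / n)⁻¹`. -/
def dataResolvent {p n : ℕ} (X : Matrix (Fin p) (Fin n) ℝ) (D : Fin n → ℝ)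
    (Y : Matrix (Fin p) (Fin n) ℝ) : Matrix (Fin p) (Fin p) ℝ :=
  (resolventInv X D Y)⁻¹

/-- `M₋ᵢ`: the matrix `M` with its column `i` replaced by `0`. -/
def dropCol {p n : ℕ} (M : Matrix (Fin p) (Fin n) ℝ) (i : Fin n) : Matrix (Fin p) (Fin n) ℝ :=
  M.updateCol i 0

/-- `Δ₋ᵢ`: the diagonal `Δ` with its entry `i` replaced by `0`. -/
def dropEntry {n : ℕ} (d : Fin n → ℝ) (i : Fin n) : Fin n → ℝ :=
  Function.update d i 0

end

/-!
Fix one index and write `z = (X, D, Y)`, `Q = Q(z)`. By the duality between the spectral and the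
nuclear norm (`exists_rankOne_decomposition`), a linear form dominated by the spectral norm is a
combination of `p` forms `A ↦ uᵀ A v` with `‖u‖, ‖v‖ ≤ 1`, with nonnegative weights of sum at most
one, so the point is to control the variations of `uᵀ Q v`.

The resolvent identity shows that `Q` is `O(1 / √n)`-Lipschitz in `X` and `Y`, but only
`O(1)`-Lipschitz in `D` for the Frobenius norm. In a fixed direction the variation in `D` is `(1 /
n) ∑ⱼ (uᵀ Q x_j) δ_j (y_jᵀ Q' v)`, hence at most `O(m / √n) ‖δ‖` if all the numbers `|uᵀ Q x_j|`
are at most `m` (`abs_dotProduct_dataResolvent_sub_le`). No path between the two triples is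
needed, so the estimate holds between any two points of the set where this bound holds.

Those numbers are of order `√(log n)`. The estimate `abs_dotProduct_dataResolvent_col_le` bounds
them by `uᵀ Q̃ x_i` and `y_jᵀ Q̃ x_i / √n`, `j ≠ i`, where `Q̃` is the resolvent of `(X₋ᵢ, D⁽ⁱ⁾,
Y₋ᵢ)` with `D⁽ⁱ⁾` truncated. In these forms the coefficient of `x_i` is independent of `x_i` and
bounded, so they have Gaussian tails, and a union bound over `n (p + n) = O(n²)` of them gives
`|uᵀ Q x_i| ≤ O(T)` for all `i` outside an event of probability `O(exp (-T²))`, as soon as `T² ≥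
log n` (`measureReal_notMem_directionalSet_le_exp`).

On the complement of that event `f(Q)` is a Lipschitz function of `z` with constant `O(T / √n)`. A
clipped McShane extension (`GaussianConcentrated.of_lipschitzOn`) then gives `ℙ(|f(Q) - f(𝔼 Q)| ≥
s) ≤ O(exp (-T²)) + O(exp (-(s √n / (b T))²))`, and `T² = max (log n, s √n)` yields the two
profiles (`le_profile_of_truncated_tail`).
-/

open scoped Matrix

/-! ### Euclidean, spectral and Frobenius norms -/

/-- The Euclidean norm of a real vector. -/
noncomputable def euclNorm {n : ℕ} (x : Fin n → ℝ) : ℝ := ‖WithLp.toLp 2 x‖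

lemma euclNorm_nonneg {n : ℕ} (x : Fin n → ℝ) : 0 ≤ euclNorm x := norm_nonneg _

lemma euclNorm_sq {n : ℕ} (x : Fin n → ℝ) : euclNorm x ^ 2 = ∑ i, x i ^ 2 := by
  simp [euclNorm, EuclideanSpace.norm_sq_eq]

lemma abs_dotProduct_le {n : ℕ} (x y : Fin n → ℝ) : |x ⬝ᵥ y| ≤ euclNorm x * euclNorm y := by
  have h := abs_real_inner_le_norm (WithLp.toLp 2 x) (WithLp.toLp 2 y)
  rwa [EuclideanSpace.inner_eq_star_dotProduct, dotProduct_comm] at h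

lemma abs_apply_le_euclNorm {n : ℕ} (x : Fin n → ℝ) (i : Fin n) : |x i| ≤ euclNorm x :=
  PiLp.norm_apply_le (WithLp.toLp 2 x) i

lemma euclNorm_smul {n : ℕ} (c : ℝ) (x : Fin n → ℝ) : euclNorm (c • x) = |c| * euclNorm x := by
  simp [euclNorm, WithLp.toLp_smul, norm_smul]

section SpectralNorm

open scoped Matrix.Norms.L2Operator

lemma specNorm_nonneg {m n : ℕ} (A : Matrix (Fin m) (Fin n) ℝ) : 0 ≤ specNorm A := norm_nonneg A

lemma euclNorm_mulVec_le {m n : ℕ} (A : Matrix (Fin m) (Fin n) ℝ) (x : Fin n → ℝ) :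
    euclNorm (A *ᵥ x) ≤ specNorm A * euclNorm x :=
  Matrix.l2_opNorm_mulVec A (WithLp.toLp 2 x)

lemma specNorm_transpose {m n : ℕ} (A : Matrix (Fin m) (Fin n) ℝ) : specNorm Aᵀ = specNorm A := by
  simpa [specNorm] using Matrix.l2_opNorm_conjTranspose A

lemma euclNorm_vecMul_le {m n : ℕ} (A : Matrix (Fin m) (Fin n) ℝ) (x : Fin m → ℝ) :
    euclNorm (x ᵥ* A) ≤ euclNorm x * specNorm A := by
  rw [← Matrix.mulVec_transpose, mul_comm, ← specNorm_transpose A]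
  exact euclNorm_mulVec_le _ _

lemma specNorm_mul_le {l m n : ℕ} (A : Matrix (Fin l) (Fin m) ℝ) (B : Matrix (Fin m) (Fin n) ℝ) :
    specNorm (A * B) ≤ specNorm A * specNorm B := Matrix.l2_opNorm_mul A B

lemma specNorm_smul {m n : ℕ} (c : ℝ) (A : Matrix (Fin m) (Fin n) ℝ) :
    specNorm (c • A) = |c| * specNorm A := by
  simp [specNorm, norm_smul]

lemma specNorm_le_of_forall {m n : ℕ} (A : Matrix (Fin m) (Fin n) ℝ) {c : ℝ} (hc : 0 ≤ c)
    (h : ∀ x, euclNorm (A *ᵥ x) ≤ c * euclNorm x) : specNorm A ≤ c := by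
  rw [specNorm, Matrix.l2_opNorm_def]
  exact ContinuousLinearMap.opNorm_le_bound _ hc fun x => h x.ofLp

lemma specNorm_diagonal_le_iff {n : ℕ} (d : Fin n → ℝ) {c : ℝ} (hc : 0 ≤ c) :
    specNorm (Matrix.diagonal d) ≤ c ↔ ∀ i, |d i| ≤ c := by
  rw [specNorm, Matrix.l2_opNorm_diagonal, pi_norm_le_iff_of_nonneg hc]
  simp

/-- A matrix at spectral distance at most `1 - e` from the identity is invertible, by the Neumann
series, and `Q = 1 + M Q` bounds its inverse. -/
lemma isUnit_one_sub_and_specNorm_inv_le {p : ℕ} (M : Matrix (Fin p) (Fin p) ℝ) {e : ℝ}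
    (he : 0 < e) (hM : specNorm M ≤ 1 - e) :
    IsUnit (1 - M) ∧ specNorm (1 - M)⁻¹ ≤ 1 / e := by
  have hu : IsUnit (1 - M) := by
    have : ‖M‖ < 1 := by
      have : ‖M‖ ≤ 1 - e := hM
      linarith
    exact isUnit_one_sub_of_norm_lt_one this
  refine ⟨hu, ?_⟩
  have hdet := (Matrix.isUnit_iff_isUnit_det _).1 hu
  have hQ : (1 - M)⁻¹ = 1 + M * (1 - M)⁻¹ := by
    have := Matrix.mul_nonsing_inv _ hdet
    rw [sub_mul, one_mul] at this
    exact sub_eq_iff_eq_add.1 this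
  have h1 : ‖(1 : Matrix (Fin p) (Fin p) ℝ)‖ ≤ 1 := by
    rw [← Matrix.diagonal_one, Matrix.l2_opNorm_diagonal, pi_norm_le_iff_of_nonneg zero_le_one]
    simp
  have h2 : ‖(1 - M)⁻¹‖ ≤ 1 + ‖M‖ * ‖(1 - M)⁻¹‖ := by
    conv_lhs => rw [hQ]
    exact (norm_add_le _ _).trans (add_le_add h1 (Matrix.l2_opNorm_mul _ _))
  have h3 : ‖M‖ * ‖(1 - M)⁻¹‖ ≤ (1 - e) * ‖(1 - M)⁻¹‖ :=
    mul_le_mul_of_nonneg_right hM (norm_nonneg _)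
  change ‖(1 - M)⁻¹‖ ≤ 1 / e
  rw [le_div_iff₀ he]
  nlinarith

end SpectralNorm

section Frobenius

open scoped Matrix.Norms.Frobenius

lemma frobNorm_nonneg {m n : ℕ} (A : Matrix (Fin m) (Fin n) ℝ) : 0 ≤ frobNorm A := norm_nonneg A

lemma frobNorm_zero {m n : ℕ} : frobNorm (0 : Matrix (Fin m) (Fin n) ℝ) = 0 := by
  simp [frobNorm]

lemma frobNorm_neg {m n : ℕ} (A : Matrix (Fin m) (Fin n) ℝ) : frobNorm (-A) = frobNorm A :=
  norm_neg A

lemma frobNorm_add_le {m n : ℕ} (A B : Matrix (Fin m) (Fin n) ℝ) :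
    frobNorm (A + B) ≤ frobNorm A + frobNorm B := norm_add_le A B

lemma frobNorm_diagonal {n : ℕ} (d : Fin n → ℝ) : frobNorm (Matrix.diagonal d) = euclNorm d :=
  Matrix.frobenius_norm_diagonal d

lemma specNorm_le_frobNorm {m n : ℕ} (A : Matrix (Fin m) (Fin n) ℝ) :
    specNorm A ≤ frobNorm A := by
  refine specNorm_le_of_forall A (frobNorm_nonneg A) fun x => ?_
  have h := Matrix.frobenius_norm_mul A (Matrix.replicateCol (Fin 1) x)
  rw [← Matrix.replicateCol_mulVec] at h
  have h1 := Matrix.frobenius_norm_replicateCol (ι := Fin 1) (A *ᵥ x)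
  have h2 := Matrix.frobenius_norm_replicateCol (ι := Fin 1) x
  exact (h1.symm.le.trans h).trans (mul_le_mul_of_nonneg_left h2.le (frobNorm_nonneg A))

end Frobenius

lemma euclNorm_col_le_specNorm {m n : ℕ} (A : Matrix (Fin m) (Fin n) ℝ) (i : Fin n) :
    euclNorm (A.col i) ≤ specNorm A := by
  have h := euclNorm_mulVec_le A (Pi.single i 1)
  rw [Matrix.mulVec_single_one] at h
  simpa [euclNorm] using h

lemma dropCol_eq_mul_diagonal {p n : ℕ} (M : Matrix (Fin p) (Fin n) ℝ) (i : Fin n) :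
    dropCol M i = M * Matrix.diagonal (fun j => if j = i then (0 : ℝ) else 1) := by
  ext a j
  by_cases h : j = i <;> simp [dropCol, h]

lemma specNorm_dropCol_le {p n : ℕ} (M : Matrix (Fin p) (Fin n) ℝ) (i : Fin n) :
    specNorm (dropCol M i) ≤ specNorm M := by
  rw [dropCol_eq_mul_diagonal]
  refine (specNorm_mul_le _ _).trans (mul_le_of_le_one_right (specNorm_nonneg _) ?_)
  rw [specNorm_diagonal_le_iff _ zero_le_one]
  intro j
  split_ifs <;> simp

lemma abs_dotProduct_diagonal_mulVec_le {n : ℕ} (a d b : Fin n → ℝ) {m : ℝ} (hm : 0 ≤ m)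
    (ha : ∀ j, |a j| ≤ m) :
    |a ⬝ᵥ Matrix.diagonal d *ᵥ b| ≤ m * euclNorm d * euclNorm b := by
  have h1 : a ⬝ᵥ Matrix.diagonal d *ᵥ b = (fun j => a j * d j) ⬝ᵥ b := by
    simp [dotProduct, Matrix.mulVec_diagonal, mul_assoc]
  have h2 : euclNorm (fun j => a j * d j) ≤ m * euclNorm d := by
    refine le_of_sq_le_sq ?_ (mul_nonneg hm (euclNorm_nonneg _))
    rw [mul_pow, euclNorm_sq, euclNorm_sq, Finset.mul_sum]
    refine Finset.sum_le_sum fun j _ => ?_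
    rw [mul_pow]
    refine mul_le_mul_of_nonneg_right ?_ (sq_nonneg _)
    rw [← sq_abs]
    exact pow_le_pow_left₀ (abs_nonneg _) (ha j) 2
  rw [h1]
  exact (abs_dotProduct_le _ _).trans (mul_le_mul_of_nonneg_right h2 (euclNorm_nonneg _))

/-! ### Duality between the spectral and the nuclear norm -/

lemma linearForm_eq_dotProduct_sum {p : ℕ} (f : Matrix (Fin p) (Fin p) ℝ →ₗ[ℝ] ℝ)
    (A : Matrix (Fin p) (Fin p) ℝ) :
    f A = ∑ i, ∑ j, A i j * f (Matrix.single i j 1) := by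
  conv_lhs => rw [Matrix.matrix_eq_sum_single A]
  simp only [map_sum]
  refine Finset.sum_congr rfl fun i _ => Finset.sum_congr rfl fun j _ => ?_
  rw [← mul_one (A i j), ← smul_eq_mul (A i j), ← Matrix.smul_single, map_smul]
  simp

/-- A linear form of norm at most one for the spectral norm is a combination of rank-one
forms with nonnegative weights of sum at most one. If `G` is the matrix of `f`, the forms and weights
are given by the singular vectors and singular values of `G`, and the sum of the singular values is
the value of `f` at the partial isometry in the polar decomposition of `G`. -/
theorem exists_rankOne_decomposition {p : ℕ} (f : Matrix (Fin p) (Fin p) ℝ →ₗ[ℝ] ℝ)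
    (hf : ∀ A, |f A| ≤ specNorm A) :
    ∃ (w : Fin p → ℝ) (u v : Fin p → Fin p → ℝ), (∀ k, 0 ≤ w k) ∧ ∑ k, w k ≤ 1 ∧
      (∀ k, euclNorm (u k) ≤ 1) ∧ (∀ k, euclNorm (v k) ≤ 1) ∧
      ∀ A, f A = ∑ k, w k * (u k ⬝ᵥ A *ᵥ v k) := by
  classical
  set G : Matrix (Fin p) (Fin p) ℝ := Matrix.of fun i j => f (Matrix.single i j 1) with hG
  set S : Matrix (Fin p) (Fin p) ℝ := Gᵀ * G with hS
  have hSH : S.IsHermitian := by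
    rw [hS]; simpa using Matrix.isHermitian_conjTranspose_mul_self G
  set b := hSH.eigenvectorBasis with hb
  set v : Fin p → Fin p → ℝ := fun k => (b k).ofLp with hv
  have hSv : ∀ k, S *ᵥ v k = hSH.eigenvalues k • v k := fun k => hSH.mulVec_eigenvectorBasis k
  have hvv : ∀ k l, v k ⬝ᵥ v l = if k = l then 1 else 0 := by
    intro k l
    have := orthonormal_iff_ite.1 b.orthonormal l k
    rw [EuclideanSpace.inner_eq_star_dotProduct] at this
    simpa [eq_comm] using this
  -- the images `G v_k` are pairwise orthogonal
  have horth : ∀ k l, k ≠ l → (G *ᵥ v k) ⬝ᵥ (G *ᵥ v l) = 0 := by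
    intro k l hkl
    rw [Matrix.dotProduct_mulVec, Matrix.vecMul_mulVec, ← Matrix.dotProduct_mulVec,
      hSv l, dotProduct_smul, hvv, if_neg hkl, smul_zero]
  set w : Fin p → ℝ := fun k => euclNorm (G *ᵥ v k) with hw
  have hw2 : ∀ k, (G *ᵥ v k) ⬝ᵥ (G *ᵥ v k) = w k ^ 2 := by
    intro k
    rw [hw, euclNorm_sq]; simp [dotProduct, sq]
  set u : Fin p → Fin p → ℝ := fun k => (w k)⁻¹ • (G *ᵥ v k) with hu
  have hwu : ∀ k, w k • u k = G *ᵥ v k := by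
    intro k
    by_cases h : w k = 0
    · have : G *ᵥ v k = 0 := by
        have h0 : WithLp.toLp 2 (G *ᵥ v k) = 0 := norm_eq_zero.1 h
        simpa using h0
      rw [this, h, zero_smul]
    · simp only [hu]; rw [smul_smul, mul_inv_cancel₀ h, one_smul]
  have huu : ∀ k l, k ≠ l → u k ⬝ᵥ u l = 0 := by
    intro k l hkl
    simp only [hu]
    rw [smul_dotProduct, dotProduct_smul, horth k l hkl]; simp
  have hu1 : ∀ k, u k ⬝ᵥ u k ≤ 1 := by
    intro k
    simp only [hu]
    rw [smul_dotProduct, dotProduct_smul, hw2, smul_eq_mul, smul_eq_mul]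
    by_cases h : w k = 0
    · simp [h]
    · field_simp; exact le_rfl
  have hexp : ∀ x : Fin p → ℝ, x = ∑ k, (v k ⬝ᵥ x) • v k := by
    intro x
    have := b.sum_repr' (WithLp.toLp 2 x)
    have h2 := congrArg WithLp.ofLp this
    simp only [EuclideanSpace.inner_eq_star_dotProduct] at h2
    conv_lhs => rw [show x = (WithLp.toLp 2 x).ofLp from rfl, ← h2]
    simp [hv, dotProduct_comm, WithLp.ofLp_sum]
  -- `f A = ⟨G, A⟩`, evaluated in the orthonormal basis `v`
  have hfA : ∀ A, f A = ∑ k, (G *ᵥ v k) ⬝ᵥ (A *ᵥ v k) := by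
    intro A
    have key : ∀ i j, ∑ k, v k i * v k j = if i = j then 1 else 0 := by
      intro i j
      have := congrFun (hexp (Pi.single i 1)) j
      simp only [Finset.sum_apply, Pi.smul_apply, smul_eq_mul, dotProduct_single_one] at this
      rw [← this, Pi.single_apply]; simp [eq_comm]
    have h3 : ∀ k, (G *ᵥ v k) ⬝ᵥ (A *ᵥ v k)
        = ∑ i, ∑ j, ∑ l, G i j * A i l * (v k j * v k l) := by
      intro k
      simp only [dotProduct, Matrix.mulVec, Finset.sum_mul_sum]
      refine Finset.sum_congr rfl fun i _ => Finset.sum_congr rfl fun j _ =>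
        Finset.sum_congr rfl fun l _ => by ring
    have h4 : ∑ k, ∑ i, ∑ j, ∑ l, G i j * A i l * (v k j * v k l)
        = ∑ i, ∑ j, ∑ l, ∑ k, G i j * A i l * (v k j * v k l) := by
      rw [Finset.sum_comm]
      refine Finset.sum_congr rfl fun i _ => ?_
      rw [Finset.sum_comm]
      exact Finset.sum_congr rfl fun j _ => Finset.sum_comm
    rw [linearForm_eq_dotProduct_sum, Finset.sum_congr rfl fun k _ => h3 k, h4]
    refine Finset.sum_congr rfl fun i _ => Finset.sum_congr rfl fun j _ => ?_
    simp_rw [← Finset.mul_sum, key]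
    simp [hG, mul_comm]
  refine ⟨w, u, v, fun k => euclNorm_nonneg _, ?_, fun k => ?_, fun k => ?_, fun A => ?_⟩
  · -- test `f` against the partial isometry `v_k ↦ u_k`
    set A : Matrix (Fin p) (Fin p) ℝ := ∑ k, Matrix.vecMulVec (u k) (v k) with hA
    have hAx : ∀ x, A *ᵥ x = ∑ k, (v k ⬝ᵥ x) • u k := by
      intro x
      rw [hA, Matrix.sum_mulVec]
      refine Finset.sum_congr rfl fun k _ => ?_
      rw [Matrix.vecMulVec_mulVec]; ext i; simp [mul_comm]
    have hAv : ∀ k, A *ᵥ v k = u k := by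
      intro k
      rw [hAx]; simp [hvv]
    have hnormA : specNorm A ≤ 1 := by
      refine specNorm_le_of_forall A zero_le_one fun x => ?_
      rw [one_mul]
      refine le_of_sq_le_sq ?_ (euclNorm_nonneg _)
      have e1 : ∀ y : Fin p → ℝ, euclNorm y ^ 2 = y ⬝ᵥ y := by
        intro y; rw [euclNorm_sq]; simp [dotProduct, sq]
      have e2 : euclNorm x ^ 2 = ∑ k, (v k ⬝ᵥ x) ^ 2 := by
        rw [e1]
        conv_lhs => rw [hexp x]
        simp only [sum_dotProduct, dotProduct_sum, smul_dotProduct, dotProduct_smul, hvv]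
        simp [sq]
      have e3 : euclNorm (A *ᵥ x) ^ 2 = ∑ k, (v k ⬝ᵥ x) ^ 2 * (u k ⬝ᵥ u k) := by
        rw [e1, hAx]
        simp only [sum_dotProduct, dotProduct_sum, smul_dotProduct, dotProduct_smul]
        refine Finset.sum_congr rfl fun k _ => ?_
        rw [Finset.sum_eq_single k]
        · simp only [smul_eq_mul]; ring
        · intro l _ hl; rw [huu l k hl]; simp
        · simp
      rw [e2, e3]
      exact Finset.sum_le_sum fun k _ => mul_le_of_le_one_right (sq_nonneg _) (hu1 k)
    have hval : f A = ∑ k, w k := by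
      rw [hfA]
      refine Finset.sum_congr rfl fun k _ => ?_
      rw [hAv]
      simp only [hu]
      rw [dotProduct_smul, hw2, smul_eq_mul]
      by_cases h : w k = 0
      · simp [h]
      · field_simp
    rw [← hval]
    exact (le_abs_self _).trans ((hf A).trans hnormA)
  · refine le_of_sq_le_sq ?_ zero_le_one
    rw [euclNorm_sq, one_pow]
    simpa [dotProduct, sq] using hu1 k
  · exact (b.orthonormal.1 k).le
  · rw [hfA]
    refine Finset.sum_congr rfl fun k _ => ?_
    rw [← hwu, smul_dotProduct, smul_eq_mul]

/-! ### Resolvent estimates -/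

/-- The spectral bounds `‖X‖, ‖Y‖ ≤ √n κ` and `‖D‖ ≤ κD` on a triple `(X, D, Y)`. -/
structure SpecBounded {p n : ℕ} (κ κD : ℝ) (X : Matrix (Fin p) (Fin n) ℝ) (D : Fin n → ℝ)
    (Y : Matrix (Fin p) (Fin n) ℝ) : Prop where
  left : specNorm X ≤ √(n : ℝ) * κ
  right : specNorm Y ≤ √(n : ℝ) * κ
  diag : specNorm (Matrix.diagonal D) ≤ κD

section Resolvent

variable {p n : ℕ} {κ κD e : ℝ} {X X' Y Y' : Matrix (Fin p) (Fin n) ℝ} {D D' : Fin n → ℝ}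

lemma mul_diagonal_mul_transpose_apply (X Y : Matrix (Fin p) (Fin n) ℝ) (D : Fin n → ℝ)
    (a b : Fin p) : (X * Matrix.diagonal D * Yᵀ) a b = ∑ j, X a j * D j * Y b j := by
  rw [Matrix.mul_apply]
  exact Finset.sum_congr rfl fun j _ => by rw [Matrix.mul_diagonal, Matrix.transpose_apply]

lemma SpecBounded.isUnit_and_specNorm_le (h : SpecBounded κ κD X D Y) (hn : 0 < n) (hκ : 0 ≤ κ)
    (he : 0 < e) (hκe : κ ^ 2 * κD ≤ 1 - e) :
    IsUnit (resolventInv X D Y) ∧ specNorm (dataResolvent X D Y) ≤ 1 / e := by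
  refine isUnit_one_sub_and_specNorm_inv_le _ he ?_
  have hn' : (0 : ℝ) < n := Nat.cast_pos.2 hn
  have hs : √(n : ℝ) * √(n : ℝ) = n := Real.mul_self_sqrt hn'.le
  have h0 : 0 ≤ √(n : ℝ) * κ := mul_nonneg (Real.sqrt_nonneg _) hκ
  have hD0 : 0 ≤ κD := (specNorm_nonneg _).trans h.diag
  have h1 : specNorm (X * Matrix.diagonal D * Yᵀ) ≤ (√(n : ℝ) * κ * κD) * (√(n : ℝ) * κ) := by
    refine (specNorm_mul_le _ _).trans ?_
    rw [specNorm_transpose]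
    refine mul_le_mul ((specNorm_mul_le _ _).trans ?_) h.right (specNorm_nonneg _)
      (mul_nonneg h0 hD0)
    exact mul_le_mul h.left h.diag (specNorm_nonneg _) h0
  rw [specNorm_smul, abs_of_pos (by positivity), one_div, inv_mul_le_iff₀ hn']
  calc specNorm (X * Matrix.diagonal D * Yᵀ)
      ≤ (√(n : ℝ) * √(n : ℝ)) * (κ ^ 2 * κD) := by linarith
    _ ≤ n * (1 - e) := by rw [hs]; exact mul_le_mul_of_nonneg_left hκe hn'.le

lemma dataResolvent_sub (h : IsUnit (resolventInv X D Y)) (h' : IsUnit (resolventInv X' D' Y')) :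
    dataResolvent X D Y - dataResolvent X' D' Y' = (1 / (n : ℝ)) •
      (dataResolvent X D Y * (X * Matrix.diagonal D * Yᵀ - X' * Matrix.diagonal D' * Y'ᵀ)
        * dataResolvent X' D' Y') := by
  have e1 : dataResolvent X D Y * resolventInv X D Y = 1 :=
    Matrix.nonsing_inv_mul _ ((Matrix.isUnit_iff_isUnit_det _).1 h)
  have e2 : resolventInv X' D' Y' * dataResolvent X' D' Y' = 1 :=
    Matrix.mul_nonsing_inv _ ((Matrix.isUnit_iff_isUnit_det _).1 h')
  have e3 : (1 / (n : ℝ)) • (X * Matrix.diagonal D * Yᵀ - X' * Matrix.diagonal D' * Y'ᵀ)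
      = resolventInv X' D' Y' - resolventInv X D Y := by
    simp only [resolventInv, smul_sub]; abel
  rw [← smul_mul_assoc, ← mul_smul_comm, e3, mul_sub, sub_mul, mul_assoc, e2, e1, mul_one, one_mul]

/-- The resolvent is Lipschitz in a fixed direction `u`, `v`, with a constant of order `m / √n`
where `m` bounds the numbers `uᵀ Q x_j`: only these enter the variation in the diagonal `D`. -/
lemma abs_dotProduct_dataResolvent_sub_le (hz : SpecBounded κ κD X D Y)
    (hz' : SpecBounded κ κD X' D' Y') (hn : 0 < n) (hκ : 0 ≤ κ) (he : 0 < e)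
    (hκe : κ ^ 2 * κD ≤ 1 - e) {u v : Fin p → ℝ} (hu : euclNorm u ≤ 1) (hv : euclNorm v ≤ 1)
    {m : ℝ} (hm : 0 ≤ m) (hum : ∀ j, |u ⬝ᵥ dataResolvent X D Y *ᵥ X.col j| ≤ m) :
    |u ⬝ᵥ (dataResolvent X D Y - dataResolvent X' D' Y') *ᵥ v|
      ≤ (2 * κ * κD / e ^ 2 + m * κ / e) / √(n : ℝ) *
        tripleNorm ((X, D, Y) - (X', D', Y') : Triple p n) := by
  obtain ⟨hU, hQ⟩ := hz.isUnit_and_specNorm_le hn hκ he hκe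
  obtain ⟨hU', hQ'⟩ := hz'.isUnit_and_specNorm_le hn hκ he hκe
  have hn' : (0 : ℝ) < n := Nat.cast_pos.2 hn
  have hsn : 0 < √(n : ℝ) := Real.sqrt_pos.2 hn'
  have hs : √(n : ℝ) * √(n : ℝ) = n := Real.mul_self_sqrt hn'.le
  have h0 : 0 ≤ √(n : ℝ) * κ := mul_nonneg hsn.le hκ
  have hD0 : 0 ≤ κD := (specNorm_nonneg _).trans hz.diag
  have he0 : 0 ≤ 1 / e := by positivity
  set N := tripleNorm ((X, D, Y) - (X', D', Y') : Triple p n) with hN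
  have hNX : frobNorm (X - X') ≤ N := le_max_left _ _
  have hND : euclNorm (D - D') ≤ N := by
    rw [← frobNorm_diagonal]; exact (le_max_left _ _).trans (le_max_right _ _)
  have hNY : frobNorm (Y - Y') ≤ N := (le_max_right _ _).trans (le_max_right _ _)
  have hN0 : 0 ≤ N := (frobNorm_nonneg _).trans hNX
  rw [dataResolvent_sub hU hU']
  set Q := dataResolvent X D Y
  set Q' := dataResolvent X' D' Y'
  set a := u ᵥ* Q with ha
  set b := Q' *ᵥ v with hb
  have ha1 : euclNorm a ≤ 1 / e := by
    refine (euclNorm_vecMul_le _ _).trans ?_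
    simpa using mul_le_mul hu hQ (specNorm_nonneg _) zero_le_one
  have hb1 : euclNorm b ≤ 1 / e := by
    refine (euclNorm_mulVec_le _ _).trans ?_
    simpa using mul_le_mul hQ' hv (euclNorm_nonneg _) he0
  have hdec : X * Matrix.diagonal D * Yᵀ - X' * Matrix.diagonal D' * Y'ᵀ
      = (X * Matrix.diagonal D) * (Y - Y')ᵀ + X * Matrix.diagonal (D - D') * Y'ᵀ
        + (X - X') * (Matrix.diagonal D' * Y'ᵀ) := by
    have : Matrix.diagonal (D - D') = Matrix.diagonal D - Matrix.diagonal D' :=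
      (Matrix.diagonal_sub D D').symm
    rw [this, Matrix.transpose_sub]
    simp only [Matrix.mul_sub, Matrix.sub_mul, Matrix.mul_assoc]
    abel
  have hsplit : u ⬝ᵥ (Q * (X * Matrix.diagonal D * Yᵀ - X' * Matrix.diagonal D' * Y'ᵀ) * Q') *ᵥ v
      = a ⬝ᵥ ((X * Matrix.diagonal D) * (Y - Y')ᵀ) *ᵥ b
        + (a ᵥ* X) ⬝ᵥ Matrix.diagonal (D - D') *ᵥ (Y'ᵀ *ᵥ b)
        + a ⬝ᵥ ((X - X') * (Matrix.diagonal D' * Y'ᵀ)) *ᵥ b := by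
    rw [← Matrix.mulVec_mulVec, ← Matrix.mulVec_mulVec, Matrix.dotProduct_mulVec, ← ha, ← hb, hdec,
      Matrix.add_mulVec, Matrix.add_mulVec, dotProduct_add, dotProduct_add]
    congr 2
    rw [← Matrix.mulVec_mulVec, ← Matrix.mulVec_mulVec, Matrix.dotProduct_mulVec]
  have hgen : ∀ M : Matrix (Fin p) (Fin p) ℝ, |a ⬝ᵥ M *ᵥ b| ≤ 1 / e * (specNorm M * (1 / e)) := by
    intro M
    refine (abs_dotProduct_le _ _).trans (mul_le_mul ha1 ?_ (euclNorm_nonneg _) he0)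
    exact (euclNorm_mulVec_le _ _).trans (mul_le_mul_of_nonneg_left hb1 (specNorm_nonneg _))
  have t1 : |a ⬝ᵥ ((X * Matrix.diagonal D) * (Y - Y')ᵀ) *ᵥ b|
      ≤ 1 / e * (√(n : ℝ) * κ * κD * N * (1 / e)) := by
    refine (hgen _).trans (mul_le_mul_of_nonneg_left (mul_le_mul_of_nonneg_right ?_ he0) he0)
    refine (specNorm_mul_le _ _).trans (mul_le_mul ((specNorm_mul_le _ _).trans
      (mul_le_mul hz.left hz.diag (specNorm_nonneg _) h0)) ?_ (specNorm_nonneg _)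
      (mul_nonneg h0 hD0))
    rw [specNorm_transpose]; exact (specNorm_le_frobNorm _).trans hNY
  have t3 : |a ⬝ᵥ ((X - X') * (Matrix.diagonal D' * Y'ᵀ)) *ᵥ b|
      ≤ 1 / e * (N * (κD * (√(n : ℝ) * κ)) * (1 / e)) := by
    refine (hgen _).trans (mul_le_mul_of_nonneg_left (mul_le_mul_of_nonneg_right ?_ he0) he0)
    refine (specNorm_mul_le _ _).trans (mul_le_mul ((specNorm_le_frobNorm _).trans hNX)
      ((specNorm_mul_le _ _).trans ?_) (specNorm_nonneg _) hN0)
    rw [specNorm_transpose]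
    exact mul_le_mul hz'.diag hz'.right (specNorm_nonneg _) hD0
  have t2 : |(a ᵥ* X) ⬝ᵥ Matrix.diagonal (D - D') *ᵥ (Y'ᵀ *ᵥ b)|
      ≤ m * N * (√(n : ℝ) * κ * (1 / e)) := by
    refine (abs_dotProduct_diagonal_mulVec_le _ _ _ hm fun j => ?_).trans ?_
    · have : (a ᵥ* X) j = u ⬝ᵥ Q *ᵥ X.col j := by
        rw [Matrix.dotProduct_mulVec]; rfl
      rw [this]; exact hum j
    · refine mul_le_mul (mul_le_mul_of_nonneg_left hND hm) ((euclNorm_mulVec_le _ _).trans ?_)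
        (euclNorm_nonneg _) (mul_nonneg hm hN0)
      rw [specNorm_transpose]
      exact mul_le_mul hz'.right hb1 (euclNorm_nonneg _) h0
  rw [Matrix.smul_mulVec, dotProduct_smul, smul_eq_mul, hsplit, abs_mul,
    abs_of_pos (by positivity)]
  have habs := (abs_add_le _ _).trans (add_le_add ((abs_add_le _ _).trans (add_le_add t1 t2)) t3)
  refine (mul_le_mul_of_nonneg_left habs (by positivity)).trans (le_of_eq ?_)
  have hn2 : (1 / (n : ℝ)) = 1 / (√(n : ℝ) * √(n : ℝ)) := by rw [hs]
  rw [hn2]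
  field_simp
  ring

/-- Leave-one-out estimate: `uᵀ Q x_i` is controlled by bilinear forms in the resolvent `Q̃` of the
triple `(X₋ᵢ, D̃, Y₋ᵢ)`. The intermediate resolvent is the one of `(X, D̂, Y)`, where `D̂` is `D̃` with
its entry `i` replaced by that of `D`: it differs from `Q̃` by a rank-one perturbation and from `Q`
only through the diagonal. -/
lemma abs_dotProduct_dataResolvent_col_le (hz : SpecBounded κ κD X D Y) {D₁ : Fin n → ℝ}
    (hD₁ : specNorm (Matrix.diagonal D₁) ≤ κD) (hn : 0 < n) (hκ : 0 ≤ κ) (he : 0 < e)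
    (hκe : κ ^ 2 * κD ≤ 1 - e) {u : Fin p → ℝ} (hu : euclNorm u ≤ 1) (i : Fin n) {K m : ℝ}
    (hK : euclNorm (dropEntry D i - dropEntry D₁ i) ≤ K)
    (hm : ∀ j, |((dropCol Y i)ᵀ *ᵥ
      (dataResolvent (dropCol X i) D₁ (dropCol Y i) *ᵥ X.col i)) j| ≤ √(n : ℝ) * m) :
    |u ⬝ᵥ dataResolvent X D Y *ᵥ X.col i|
      ≤ (1 + 1 / e) * (|u ⬝ᵥ dataResolvent (dropCol X i) D₁ (dropCol Y i) *ᵥ X.col i|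
        + K * κ / e * m) := by
  have hn' : (0 : ℝ) < n := Nat.cast_pos.2 hn
  have hsn : 0 < √(n : ℝ) := Real.sqrt_pos.2 hn'
  have hs : √(n : ℝ) * √(n : ℝ) = n := Real.mul_self_sqrt hn'.le
  have h0 : 0 ≤ √(n : ℝ) * κ := mul_nonneg hsn.le hκ
  have hD0 : 0 ≤ κD := (specNorm_nonneg _).trans hz.diag
  have he0 : 0 ≤ 1 / e := by positivity
  have hm0 : 0 ≤ m := by
    have := (abs_nonneg _).trans (hm i)
    exact nonneg_of_mul_nonneg_right this hsn
  have hK0 : 0 ≤ K := (euclNorm_nonneg _).trans hK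
  have hDi : ∀ j, |D j| ≤ κD := (specNorm_diagonal_le_iff _ hD0).1 hz.diag
  have hD₁j : ∀ j, |D₁ j| ≤ κD := (specNorm_diagonal_le_iff _ hD0).1 hD₁
  set D₂ : Fin n → ℝ := Function.update D₁ i (D i) with hD₂
  have hz₁ : SpecBounded κ κD (dropCol X i) D₁ (dropCol Y i) :=
    ⟨(specNorm_dropCol_le _ _).trans hz.left, (specNorm_dropCol_le _ _).trans hz.right, hD₁⟩
  have hz₂ : SpecBounded κ κD X D₂ Y := by
    refine ⟨hz.left, hz.right, (specNorm_diagonal_le_iff _ hD0).2 fun j => ?_⟩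
    by_cases h : j = i
    · subst h; simpa [hD₂] using hDi j
    · simpa [hD₂, h] using hD₁j j
  obtain ⟨hU, hQ⟩ := hz.isUnit_and_specNorm_le hn hκ he hκe
  obtain ⟨hU₁, hQ₁⟩ := hz₁.isUnit_and_specNorm_le hn hκ he hκe
  obtain ⟨hU₂, hQ₂⟩ := hz₂.isUnit_and_specNorm_le hn hκ he hκe
  have hsub₂ := dataResolvent_sub hU₁ hU₂
  have hsub := dataResolvent_sub hU hU₂
  set Q := dataResolvent X D Y
  set Q₁ := dataResolvent (dropCol X i) D₁ (dropCol Y i)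
  set Q₂ := dataResolvent X D₂ Y
  set x := X.col i with hx
  set y := Y.col i with hy
  have hxn : euclNorm x ≤ √(n : ℝ) * κ := (euclNorm_col_le_specNorm X i).trans hz.left
  have hyn : euclNorm y ≤ √(n : ℝ) * κ := (euclNorm_col_le_specNorm Y i).trans hz.right
  -- `Q₂ x_i` is a bounded multiple of `Q₁ x_i`
  obtain ⟨θ, hθ, hQx⟩ : ∃ θ : ℝ, |θ| ≤ 1 + 1 / e ∧ Q₂ *ᵥ x = θ • (Q₁ *ᵥ x) := by
    refine ⟨1 + 1 / (n : ℝ) * (D i * (y ⬝ᵥ Q₂ *ᵥ x)), ?_, ?_⟩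
    · have h1 : |y ⬝ᵥ Q₂ *ᵥ x| ≤ √(n : ℝ) * κ * (1 / e * (√(n : ℝ) * κ)) :=
        (abs_dotProduct_le _ _).trans (mul_le_mul hyn ((euclNorm_mulVec_le _ _).trans
          (mul_le_mul hQ₂ hxn (euclNorm_nonneg _) he0)) (euclNorm_nonneg _) h0)
      refine (abs_add_le _ _).trans ?_
      rw [abs_one, abs_mul, abs_mul, abs_of_pos (show 0 < 1 / (n : ℝ) by positivity)]
      have h2 : |D i| * |y ⬝ᵥ Q₂ *ᵥ x| ≤ κD * (√(n : ℝ) * κ * (1 / e * (√(n : ℝ) * κ))) :=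
        mul_le_mul (hDi i) h1 (abs_nonneg _) hD0
      have h3 : 1 / (n : ℝ) * (|D i| * |y ⬝ᵥ Q₂ *ᵥ x|) ≤ 1 / e := by
        rw [one_div (n : ℝ), inv_mul_le_iff₀ hn']
        refine h2.trans ?_
        have : κD * (√(n : ℝ) * κ * (1 / e * (√(n : ℝ) * κ)))
            = (√(n : ℝ) * √(n : ℝ)) * (1 / e) * (κ ^ 2 * κD) := by ring
        rw [this, hs]
        exact mul_le_of_le_one_right (by positivity) (by linarith)
      linarith
    · have hrank : dropCol X i * Matrix.diagonal D₁ * (dropCol Y i)ᵀ - X * Matrix.diagonal D₂ * Yᵀ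
          = -(D i) • Matrix.vecMulVec x y := by
        ext a b
        rw [Matrix.sub_apply, mul_diagonal_mul_transpose_apply, mul_diagonal_mul_transpose_apply,
          Matrix.smul_apply, Matrix.vecMulVec_apply, smul_eq_mul]
        rw [← Finset.sum_sub_distrib, Finset.sum_eq_single i]
        · simp [dropCol, hD₂, hx, hy]; ring
        · intro j _ hj
          simp [dropCol, hD₂, hj]
        · simp
      rw [hrank] at hsub₂
      have h4 : Q₂ = Q₁ + (1 / (n : ℝ) * D i) • (Q₁ * Matrix.vecMulVec x y * Q₂) := by
        rw [neg_smul, Matrix.mul_neg, Matrix.neg_mul, smul_neg, Matrix.mul_smul, Matrix.smul_mul,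
          smul_smul, sub_eq_iff_eq_add] at hsub₂
        rw [neg_add_eq_sub, eq_sub_iff_add_eq, add_comm] at hsub₂
        exact hsub₂.symm.trans (add_comm _ _)
      have h5 : (Q₁ * Matrix.vecMulVec x y * Q₂) *ᵥ x = (y ⬝ᵥ Q₂ *ᵥ x) • (Q₁ *ᵥ x) := by
        rw [← Matrix.mulVec_mulVec, ← Matrix.mulVec_mulVec, Matrix.vecMulVec_mulVec,
          ← Matrix.mulVec_smul]
        congr 1; ext k; simp [mul_comm]
      conv_lhs => rw [h4]
      rw [Matrix.add_mulVec, Matrix.smul_mulVec, h5, smul_smul, add_smul, one_smul, mul_assoc]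
  -- `Q` and `Q₂` differ through the diagonal only, where the entry `i` does not contribute
  have hdiag : X * Matrix.diagonal D * Yᵀ - X * Matrix.diagonal D₂ * Yᵀ
      = X * Matrix.diagonal (dropEntry D i - dropEntry D₁ i) * (dropCol Y i)ᵀ := by
    ext a b
    rw [Matrix.sub_apply, mul_diagonal_mul_transpose_apply, mul_diagonal_mul_transpose_apply,
      mul_diagonal_mul_transpose_apply, ← Finset.sum_sub_distrib]
    refine Finset.sum_congr rfl fun j _ => ?_
    by_cases h : j = i
    · subst h; simp [dropCol, hD₂, dropEntry]
    · simp [dropCol, hD₂, dropEntry, h]; ring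
  rw [hdiag, sub_eq_iff_eq_add] at hsub
  set δ := dropEntry D i - dropEntry D₁ i
  have hsplit : u ⬝ᵥ Q *ᵥ x = θ * (u ⬝ᵥ Q₁ *ᵥ x)
      + 1 / (n : ℝ) * (θ * (((dropCol Y i)ᵀ *ᵥ (Q₁ *ᵥ x)) ⬝ᵥ
        Matrix.diagonal δ *ᵥ (u ᵥ* Q ᵥ* X))) := by
    conv_lhs => rw [hsub]
    rw [Matrix.add_mulVec, dotProduct_add, hQx, dotProduct_smul, smul_eq_mul, add_comm,
      Matrix.smul_mulVec, dotProduct_smul, smul_eq_mul]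
    congr 2
    rw [← Matrix.mulVec_mulVec, hQx, Matrix.mulVec_smul, dotProduct_smul, smul_eq_mul]
    congr 1
    rw [← Matrix.mulVec_mulVec, ← Matrix.mulVec_mulVec, ← Matrix.mulVec_mulVec,
      Matrix.dotProduct_mulVec, Matrix.dotProduct_mulVec]
    simp only [dotProduct, Matrix.mulVec_diagonal]
    exact Finset.sum_congr rfl fun j _ => by ring
  have ha : euclNorm (u ᵥ* Q ᵥ* X) ≤ 1 / e * (√(n : ℝ) * κ) := by
    refine (euclNorm_vecMul_le _ _).trans (mul_le_mul ?_ hz.left (specNorm_nonneg _) he0)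
    refine (euclNorm_vecMul_le _ _).trans ?_
    simpa using mul_le_mul hu hQ (specNorm_nonneg _) zero_le_one
  have hlast : |((dropCol Y i)ᵀ *ᵥ (Q₁ *ᵥ x)) ⬝ᵥ Matrix.diagonal δ *ᵥ (u ᵥ* Q ᵥ* X)|
      ≤ n * (K * κ / e * m) := by
    refine (abs_dotProduct_diagonal_mulVec_le _ _ _ (mul_nonneg hsn.le hm0) hm).trans ?_
    refine (mul_le_mul (mul_le_mul_of_nonneg_left hK (mul_nonneg hsn.le hm0)) ha
      (euclNorm_nonneg _) (by positivity)).trans (le_of_eq ?_)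
    calc _ = (√(n : ℝ) * √(n : ℝ)) * (K * κ / e * m) := by ring
      _ = _ := by rw [hs]
  have hlast' : 1 / (n : ℝ) *
      |((dropCol Y i)ᵀ *ᵥ (Q₁ *ᵥ x)) ⬝ᵥ Matrix.diagonal δ *ᵥ (u ᵥ* Q ᵥ* X)|
      ≤ K * κ / e * m := by
    rwa [one_div, inv_mul_le_iff₀ hn']
  rw [hsplit]
  refine (abs_add_le _ _).trans ?_
  rw [abs_mul, abs_mul, abs_mul, abs_of_pos (show 0 < 1 / (n : ℝ) by positivity), mul_left_comm,
    ← mul_add]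
  exact mul_le_mul hθ (add_le_add_right hlast' _) (by positivity) (by positivity)

end Resolvent

/-! ### Measurability, concentration and independence -/

section Measurability

instance matrixBorelSpace {m n : Type*} [Countable m] [Countable n] : BorelSpace (Matrix m n ℝ) :=
  inferInstanceAs (BorelSpace (m → n → ℝ))

variable {α : Type*} [MeasurableSpace α] {p n : ℕ}

lemma measurable_matrix_iff {f : α → Matrix (Fin p) (Fin n) ℝ} :
    Measurable f ↔ ∀ i j, Measurable fun a => f a i j :=
  ⟨fun h i j => measurable_pi_iff.1 (measurable_pi_iff.1 h i) j,
    fun h => measurable_pi_iff.2 fun i => measurable_pi_iff.2 fun j => h i j⟩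

lemma Measurable.matrix_inv {f : α → Matrix (Fin p) (Fin p) ℝ} (hf : Measurable f) :
    Measurable fun a => (f a)⁻¹ := by
  have hdet : Measurable fun a => (f a).det :=
    (continuous_id.matrix_det : Continuous fun A : Matrix (Fin p) (Fin p) ℝ => A.det).measurable.comp
      hf
  have hadj : ∀ i j, Measurable fun a => (f a).adjugate i j := fun i j =>
    (continuous_id.matrix_adjugate.matrix_elem i j :
      Continuous fun A : Matrix (Fin p) (Fin p) ℝ => A.adjugate i j).measurable.comp hf
  refine measurable_matrix_iff.2 fun i j => ?_
  simp only [Matrix.inv_def, Matrix.smul_apply, Ring.inverse_eq_inv', smul_eq_mul]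
  exact hdet.inv.mul (hadj i j)

lemma Measurable.dataResolvent {X Y : α → Matrix (Fin p) (Fin n) ℝ} {D : α → Fin n → ℝ}
    (hX : Measurable X) (hD : Measurable D) (hY : Measurable Y) :
    Measurable fun a => dataResolvent (X a) (D a) (Y a) := by
  refine Measurable.matrix_inv (measurable_matrix_iff.2 fun i j => ?_)
  simp only [resolventInv, Matrix.sub_apply, Matrix.smul_apply, mul_diagonal_mul_transpose_apply,
    smul_eq_mul]
  refine measurable_const.sub (measurable_const.mul (Finset.measurable_sum _ fun k _ => ?_))
  exact ((measurable_matrix_iff.1 hX i k).mul (measurable_pi_iff.1 hD k)).mul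
    (measurable_matrix_iff.1 hY j k)

lemma Measurable.euclNorm {f : α → Fin n → ℝ} (hf : Measurable f) :
    Measurable fun a => euclNorm (f a) := by
  have : (fun a => _root_.euclNorm (f a)) = fun a => √(∑ i, f a i ^ 2) := by
    ext a; rw [← euclNorm_sq, Real.sqrt_sq (euclNorm_nonneg _)]
  rw [this]
  exact (Finset.measurable_sum _ fun i _ => (measurable_pi_iff.1 hf i).pow_const 2).sqrt

lemma Measurable.dotProduct {f g : α → Fin n → ℝ} (hf : Measurable f) (hg : Measurable g) :
    Measurable fun a => f a ⬝ᵥ g a :=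
  Finset.measurable_sum _ fun i _ => (measurable_pi_iff.1 hf i).mul (measurable_pi_iff.1 hg i)

lemma Measurable.vecMul {f : α → Fin p → ℝ} {A : α → Matrix (Fin p) (Fin n) ℝ}
    (hf : Measurable f) (hA : Measurable A) : Measurable fun a => f a ᵥ* A a :=
  measurable_pi_iff.2 fun j => hf.dotProduct
    (measurable_pi_iff.2 fun i => measurable_matrix_iff.1 hA i j)

end Measurability

section Concentration

variable {Ω : Type*} [MeasurableSpace Ω] {μ : Measure Ω} {E : Type*} [AddCommGroup E]
  {N : E → ℝ} {Z : Ω → E} {C c : ℝ}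

/-- Gaussian concentration of the `N`-Lipschitz observations of one random vector, with explicit
constants. -/
def GaussianConcentrated (μ : Measure Ω) (N : E → ℝ) (Z : Ω → E) (C c : ℝ) : Prop :=
  ∀ f : E → ℝ, (∀ x y, |f x - f y| ≤ N (x - y)) →
    Integrable (fun ω => f (Z ω)) μ ∧
    ∀ s : ℝ, 0 < s →
      μ.real {ω | s ≤ |f (Z ω) - ∫ ω', f (Z ω') ∂μ|} ≤ C * Real.exp (-(s / c) ^ 2)

lemma GaussianConcentrated.of_lipschitz (h : GaussianConcentrated μ N Z C c) {L : ℝ} (hL : 0 < L)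
    {f : E → ℝ} (hf : ∀ x y, |f x - f y| ≤ L * N (x - y)) :
    Integrable (fun ω => f (Z ω)) μ ∧
    ∀ s : ℝ, 0 < s →
      μ.real {ω | s ≤ |f (Z ω) - ∫ ω', f (Z ω') ∂μ|} ≤ C * Real.exp (-(s / (c * L)) ^ 2) := by
  obtain ⟨h1, h2⟩ := h (fun x => f x / L) fun x y => by
    rw [← sub_div, abs_div, abs_of_pos hL, div_le_iff₀ hL, mul_comm]; exact hf x y
  refine ⟨by simpa [hL.ne'] using h1.mul_const L, fun s hs => ?_⟩
  have h3 := h2 (s / L) (by positivity)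
  rw [integral_div] at h3
  have : ∀ ω, (s / L ≤ |f (Z ω) / L - (∫ ω', f (Z ω') ∂μ) / L|) ↔
      s ≤ |f (Z ω) - ∫ ω', f (Z ω') ∂μ| := by
    intro ω
    rw [← sub_div, abs_div, abs_of_pos hL, div_le_div_iff_of_pos_right hL]
  simp only [this] at h3
  rwa [div_div, mul_comm L c] at h3

/-- An observable that is Lipschitz only on a set `A` of probability at least `1 - δ` still
concentrates around its mean: it is replaced by a Lipschitz extension (McShane), clipped at the
level `M`, whose mean differs by at most `2 M δ`. -/
theorem GaussianConcentrated.of_lipschitzOn [IsProbabilityMeasure μ] (hN0 : N 0 = 0)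
    (hNneg : ∀ x, N (-x) = N x) (hNadd : ∀ x y, N (x + y) ≤ N x + N y)
    (h : GaussianConcentrated μ N Z C c) {A : Set E} {F : E → ℝ} {L M δ : ℝ} (hL : 0 < L)
    (hF : ∀ x ∈ A, ∀ y ∈ A, |F x - F y| ≤ L * N (x - y)) (hFA : ∀ x ∈ A, |F x| ≤ M)
    (hFM : ∀ᵐ ω ∂μ, |F (Z ω)| ≤ M) (hFi : Integrable (fun ω => F (Z ω)) μ)
    (hδ : μ.real {ω | Z ω ∉ A} ≤ δ) {s : ℝ} (hs : 0 < s) (hMδ : 2 * M * δ ≤ s / 2) :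
    μ.real {ω | s ≤ |F (Z ω) - ∫ ω', F (Z ω') ∂μ|}
      ≤ δ + C * Real.exp (-(s / (2 * c * L)) ^ 2) := by
  obtain ⟨ω₀, hω₀⟩ := hFM.exists
  have hM : 0 ≤ M := (abs_nonneg _).trans hω₀
  obtain ⟨g, hgL, hgF, hgM⟩ : ∃ g : E → ℝ, (∀ x y, |g x - g y| ≤ L * N (x - y)) ∧
      (∀ x ∈ A, g x = F x) ∧ ∀ x, |g x| ≤ M := by
    let _ : PseudoMetricSpace E :=
      { dist := fun x y => N (x - y)
        dist_self := fun x => by simp [hN0]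
        dist_comm := fun x y => by rw [← hNneg, neg_sub]
        dist_triangle := fun x y z => by
          rw [← sub_add_sub_cancel x y z]; exact hNadd _ _ }
    have hLip : LipschitzOnWith L.toNNReal F A := by
      refine LipschitzOnWith.of_dist_le_mul fun x hx y hy => ?_
      rw [Real.dist_eq, Real.coe_toNNReal _ hL.le]
      exact hF x hx y hy
    obtain ⟨g, hg, hgA⟩ := hLip.extend_real
    refine ⟨fun x => max (-M) (min M (g x)), fun x y => ?_, fun x hx => ?_, fun x => ?_⟩
    · have := ((hg.const_min M).const_max (-M)).dist_le_mul x y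
      rwa [Real.dist_eq, Real.coe_toNNReal _ hL.le] at this
    · have h1 := abs_le.1 (hFA x hx)
      simp only [← hgA hx]
      rw [min_eq_right h1.2, max_eq_right h1.1]
    · exact abs_le.2 ⟨le_max_left _ _, max_le (by linarith) (min_le_left _ _)⟩
  obtain ⟨hgi, hgc⟩ := h.of_lipschitz hL hgL
  set S := {ω | Z ω ∉ A} with hS
  have hmean : |∫ ω, F (Z ω) ∂μ - ∫ ω, g (Z ω) ∂μ| ≤ s / 2 := by
    rw [← integral_sub hFi hgi]
    refine abs_integral_le_integral_abs.trans ?_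
    have hle : ∫ ω, |F (Z ω) - g (Z ω)| ∂μ
        ≤ ∫ ω, (toMeasurable μ S).indicator (fun _ => 2 * M) ω ∂μ := by
      refine integral_mono_ae (hFi.sub hgi).abs
        ((integrable_const _).indicator (measurableSet_toMeasurable μ S)) ?_
      filter_upwards [hFM] with ω hω
      by_cases hωS : ω ∈ S
      · rw [Set.indicator_of_mem (subset_toMeasurable μ S hωS)]
        refine (abs_sub _ _).trans ?_
        linarith [hgM (Z ω)]
      · have hωA : Z ω ∈ A := by simpa [hS] using hωS
        simp only [hgF _ hωA, sub_self, abs_zero]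
        exact Set.indicator_nonneg (fun _ _ => by linarith) _
    refine hle.trans ?_
    rw [integral_indicator_const _ (measurableSet_toMeasurable μ S), smul_eq_mul, measureReal_def,
      measure_toMeasurable, ← measureReal_def]
    refine le_trans ?_ hMδ
    rw [mul_comm]
    exact mul_le_mul_of_nonneg_left hδ (by linarith)
  have hsub : {ω | s ≤ |F (Z ω) - ∫ ω', F (Z ω') ∂μ|}
      ⊆ S ∪ {ω | s / 2 ≤ |g (Z ω) - ∫ ω', g (Z ω') ∂μ|} := by
    intro ω hω
    by_cases hωS : ω ∈ S
    · exact Or.inl hωS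
    · right
      have hωA : Z ω ∈ A := by simpa [hS] using hωS
      have hω' : s ≤ |F (Z ω) - ∫ ω', F (Z ω') ∂μ| := hω
      rw [Set.mem_ofPred_eq, hgF _ hωA]
      have := abs_sub_le (F (Z ω)) (∫ ω', g (Z ω') ∂μ) (∫ ω', F (Z ω') ∂μ)
      rw [abs_sub_comm (∫ ω', g (Z ω') ∂μ)] at this
      linarith
  refine (measureReal_mono hsub).trans ((measureReal_union_le _ _).trans (add_le_add hδ ?_))
  have h4 := hgc (s / 2) (by positivity)
  rwa [div_div, ← mul_assoc] at h4

end Concentration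

/-- Freezing an independent variable: a tail bound uniform over the deterministic vectors `a` of
norm at most `R` holds for a random vector `w(W)` when `W` is independent of `x`. -/
lemma measureReal_le_of_indepFun {Ω β : Type*} [MeasurableSpace Ω] [MeasurableSpace β]
    {μ : Measure Ω} [IsProbabilityMeasure μ] {p : ℕ} {W : Ω → β} {x : Ω → Fin p → ℝ}
    (hW : Measurable W) (hx : Measurable x) (hind : IndepFun W x μ) {w : β → Fin p → ℝ}
    (hw : Measurable w) {R τ η : ℝ} (hη : 0 ≤ η)
    (h : ∀ a, euclNorm a ≤ R → μ.real {ω | τ ≤ |a ⬝ᵥ x ω|} ≤ η) :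
    μ.real {ω | euclNorm (w (W ω)) ≤ R ∧ τ ≤ |w (W ω) ⬝ᵥ x ω|} ≤ η := by
  set T : Set (β × (Fin p → ℝ)) := {q | euclNorm (w q.1) ≤ R ∧ τ ≤ |w q.1 ⬝ᵥ q.2|} with hT
  have hTm : MeasurableSet T :=
    (measurableSet_le (hw.comp measurable_fst).euclNorm measurable_const).inter
      (measurableSet_le measurable_const ((hw.comp measurable_fst).dotProduct measurable_snd).abs)
  have hmap := (indepFun_iff_map_prod_eq_prod_map_map hW.aemeasurable hx.aemeasurable).1 hind
  have : IsProbabilityMeasure (μ.map W) := Measure.isProbabilityMeasure_map hW.aemeasurable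
  have : IsProbabilityMeasure (μ.map x) := Measure.isProbabilityMeasure_map hx.aemeasurable
  have hμ : μ {ω | euclNorm (w (W ω)) ≤ R ∧ τ ≤ |w (W ω) ⬝ᵥ x ω|} ≤ ENNReal.ofReal η := by
    have h1 : μ {ω | euclNorm (w (W ω)) ≤ R ∧ τ ≤ |w (W ω) ⬝ᵥ x ω|}
        = (μ.map fun ω => (W ω, x ω)) T := by
      rw [Measure.map_apply (hW.prodMk hx) hTm]; rfl
    rw [h1, hmap, Measure.prod_apply hTm]
    refine (lintegral_mono (g := fun _ => ENNReal.ofReal η) fun b => ?_).trans (by simp)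
    rw [Measure.map_apply hx (measurable_prodMk_left hTm)]
    by_cases hb : euclNorm (w b) ≤ R
    · refine (measure_mono (t := {ω | τ ≤ |w b ⬝ᵥ x ω|}) fun ω hω => hω.2).trans ?_
      rw [← ofReal_measureReal]
      exact ENNReal.ofReal_le_ofReal (h _ hb)
    · have : x ⁻¹' (Prod.mk b ⁻¹' T) = ∅ := by
        ext ω; simp [hT, hb]
      simp [this]
  exact ENNReal.toReal_le_of_le_ofReal hη hμ

section Columns

variable {Ω : Type*} [MeasurableSpace Ω] {μ : Measure Ω} [IsProbabilityMeasure μ] {p n : ℕ}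
  {X Y : Ω → Matrix (Fin p) (Fin n) ℝ} {D : Ω → Fin n → ℝ} {C c : ℝ}

lemma GaussianConcentrated.dotProduct_col_le
    (h : GaussianConcentrated μ (tripleNorm (p := p) (n := n)) (fun ω => (X ω, D ω, Y ω)) C c)
    {i : Fin n} {K : ℝ} (hK : ‖WithLp.toLp 2 (fun k => ∫ ω, X ω k i ∂μ)‖ ≤ K)
    {R : ℝ} (hR : 0 < R) {a : Fin p → ℝ} (ha : euclNorm a ≤ R) {s : ℝ} (hs : 0 < s) :
    μ.real {ω | R * K + s ≤ |a ⬝ᵥ (X ω).col i|} ≤ C * Real.exp (-(s / (c * R)) ^ 2) := by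
  have hcol : ∀ z z' : Triple p n, euclNorm ((z.1 - z'.1).col i) ≤ tripleNorm (z - z') :=
    fun z z' => (euclNorm_col_le_specNorm _ i).trans
      ((specNorm_le_frobNorm _).trans (le_max_left _ _))
  have hent : ∀ k, Integrable (fun ω => X ω k i) μ := fun k =>
    (h (fun z => z.1 k i) fun z z' => (abs_apply_le_euclNorm _ k).trans (hcol z z')).1
  have hlip : ∀ z z' : Triple p n,
      |a ⬝ᵥ z.1.col i - a ⬝ᵥ z'.1.col i| ≤ R * tripleNorm (z - z') := by
    intro z z'
    rw [← dotProduct_sub]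
    exact (abs_dotProduct_le _ _).trans (mul_le_mul ha (hcol z z') (euclNorm_nonneg _) hR.le)
  obtain ⟨-, h2⟩ := h.of_lipschitz hR hlip
  have hmean : |∫ ω, a ⬝ᵥ (X ω).col i ∂μ| ≤ R * K := by
    have : ∫ ω, a ⬝ᵥ (X ω).col i ∂μ = a ⬝ᵥ fun k => ∫ ω, X ω k i ∂μ := by
      simp only [dotProduct, Matrix.col_apply]
      rw [integral_finsetSum _ fun k _ => (hent k).const_mul _]
      exact Finset.sum_congr rfl fun k _ => integral_const_mul _ _
    rw [this]
    exact (abs_dotProduct_le _ _).trans (mul_le_mul ha hK (euclNorm_nonneg _) hR.le)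
  refine (measureReal_mono fun ω hω => ?_).trans (h2 s hs)
  have hω' : R * K + s ≤ |a ⬝ᵥ (X ω).col i| := hω
  have := abs_sub_abs_le_abs_sub (a ⬝ᵥ (X ω).col i) (∫ ω, a ⬝ᵥ (X ω).col i ∂μ)
  rw [Set.mem_ofPred_eq]
  linarith

end Columns

/-! ### Concentration of the resolvent at a fixed truncation level -/

lemma euclNorm_le_of_abs_le {n : ℕ} {x y : Fin n → ℝ} (h : ∀ i, |x i| ≤ |y i|) :
    euclNorm x ≤ euclNorm y := by
  refine le_of_sq_le_sq ?_ (euclNorm_nonneg _)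
  rw [euclNorm_sq, euclNorm_sq]
  exact Finset.sum_le_sum fun i _ => sq_le_sq.2 (h i)

lemma tripleNorm_zero {p n : ℕ} : tripleNorm (0 : Triple p n) = 0 := by
  have : Matrix.diagonal (0 : Fin n → ℝ) = 0 := Matrix.diagonal_zero
  simp [tripleNorm, this, frobNorm_zero]

lemma tripleNorm_neg {p n : ℕ} (z : Triple p n) : tripleNorm (-z) = tripleNorm z := by
  have : Matrix.diagonal (-z.2.1) = -Matrix.diagonal z.2.1 := (Matrix.diagonal_neg _).symm
  simp only [tripleNorm, Prod.fst_neg, Prod.snd_neg, this, frobNorm_neg]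

lemma tripleNorm_add_le {p n : ℕ} (z z' : Triple p n) :
    tripleNorm (z + z') ≤ tripleNorm z + tripleNorm z' := by
  have : Matrix.diagonal (z.2.1 + z'.2.1) = Matrix.diagonal z.2.1 + Matrix.diagonal z'.2.1 :=
    (Matrix.diagonal_add _ _).symm
  simp only [tripleNorm, Prod.fst_add, Prod.snd_add, this]
  refine max_le ((frobNorm_add_le _ _).trans (add_le_add (le_max_left _ _) (le_max_left _ _)))
    (max_le ?_ ?_)
  · exact (frobNorm_add_le _ _).trans (add_le_add ((le_max_left _ _).trans (le_max_right _ _))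
      ((le_max_left _ _).trans (le_max_right _ _)))
  · exact (frobNorm_add_le _ _).trans (add_le_add ((le_max_right _ _).trans (le_max_right _ _))
      ((le_max_right _ _).trans (le_max_right _ _)))

/-- Truncation of the entries of a diagonal to `[-a, a]`. -/
def clipEntries {n : ℕ} (a : ℝ) (d : Fin n → ℝ) : Fin n → ℝ := fun j => max (-a) (min a (d j))

lemma abs_clipEntries_le {n : ℕ} {a : ℝ} (ha : 0 ≤ a) (d : Fin n → ℝ) (j : Fin n) :
    |clipEntries a d j| ≤ a :=
  abs_le.2 ⟨le_max_left _ _, max_le (by linarith) (min_le_left _ _)⟩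

lemma euclNorm_dropEntry_sub_clipEntries_le {n : ℕ} {a : ℝ} {d : Fin n → ℝ} (hd : ∀ j, |d j| ≤ a)
    (d' : Fin n → ℝ) (i : Fin n) :
    euclNorm (dropEntry d i - dropEntry (clipEntries a d') i)
      ≤ euclNorm (dropEntry d i - dropEntry d' i) := by
  refine euclNorm_le_of_abs_le fun j => ?_
  by_cases h : j = i
  · subst h; simp [dropEntry]
  · have h1 : d j = max (-a) (min a (d j)) := by
      have := abs_le.1 (hd j)
      rw [min_eq_right this.2, max_eq_right this.1]
    simp only [dropEntry, Pi.sub_apply, Function.update_of_ne h]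
    conv_lhs => rw [h1]
    refine (abs_max_sub_max_le_max _ _ _ _).trans (max_le (by simp) ?_)
    exact (abs_min_sub_min_le_max _ _ _ _).trans (max_le (by simp) le_rfl)

/-- The hypotheses on one random triple `(X, D, Y)`, with explicit constants: `C`, `c` for the
concentration, a lower bound `e` on the spectral gap, and one number `K` bounding all the other
parameters. -/
structure BoundedConcentratedTriple {Ω : Type*} [MeasurableSpace Ω] (μ : Measure Ω) {p n : ℕ}
    (X : Ω → Matrix (Fin p) (Fin n) ℝ) (D : Ω → Fin n → ℝ) (Y : Ω → Matrix (Fin p) (Fin n) ℝ)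
    (C c K e κ κD : ℝ) : Prop where
  measurable_left : Measurable X
  measurable_right : Measurable Y
  measurable_diag : Measurable D
  dim_pos : 0 < n
  dim_le : (p : ℝ) ≤ K * n
  const_pos : 0 < C
  scale_pos : 0 < c
  bound_nonneg : 0 ≤ K
  gap_pos : 0 < e
  conc : GaussianConcentrated μ (tripleNorm (p := p) (n := n)) (fun ω => (X ω, D ω, Y ω)) C c
  mean_le : ∀ i, ‖WithLp.toLp 2 (fun k => ∫ ω, X ω k i ∂μ)‖ ≤ K
  exists_indep : ∀ i, ∃ Di : Ω → Fin n → ℝ, Measurable Di ∧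
    IndepFun (fun ω => (dropCol (X ω) i, dropCol (Y ω) i, Di ω)) (fun ω => (X ω).col i) μ ∧
    ∀ᵐ ω ∂μ, euclNorm (dropEntry (D ω) i - dropEntry (Di ω) i) ≤ K
  kappa_nonneg : 0 ≤ κ
  kappa_le : κ ≤ K
  kappaD_nonneg : 0 ≤ κD
  kappaD_le : κD ≤ K
  ae_bounded : ∀ᵐ ω ∂μ, SpecBounded κ κD (X ω) (D ω) (Y ω)
  gap : κ ^ 2 * κD ≤ 1 - e

namespace BoundedConcentratedTriple

variable {Ω : Type*} [MeasurableSpace Ω] {μ : Measure Ω} [IsProbabilityMeasure μ] {p n : ℕ}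
  {X Y : Ω → Matrix (Fin p) (Fin n) ℝ} {D : Ω → Fin n → ℝ} {C c K e κ κD : ℝ}

/-- The set of triples satisfying the spectral bounds for which all the numbers `uₖᵀ Q x_i` are at
most `m`. -/
def directionalSet (κ κD : ℝ) (u : Fin p → Fin p → ℝ) (m : ℝ) : Set (Triple p n) :=
  {z | SpecBounded κ κD z.1 z.2.1 z.2.2 ∧
    ∀ k i, |u k ⬝ᵥ dataResolvent z.1 z.2.1 z.2.2 *ᵥ z.1.col i| ≤ m}

/-- Union bound over the `n (p + n)` bilinear forms of the leave-one-out estimate, each of them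
linear in `x_i` with a coefficient vector independent of `x_i`. -/
lemma measureReal_notMem_directionalSet_le (h : BoundedConcentratedTriple μ X D Y C c K e κ κD)
    {u : Fin p → Fin p → ℝ} (hu : ∀ k, euclNorm (u k) ≤ 1) {s : ℝ} (hs : 0 < s) :
    μ.real {ω | (X ω, D ω, Y ω) ∉ directionalSet κ κD u
        ((1 + 1 / e) * (1 + K * K / e) * ((1 + K) / e * K + s))}
      ≤ (p + n) * n * (C * Real.exp (-(s / (c * ((1 + K) / e))) ^ 2)) := by
  have hK := h.bound_nonneg
  have he := h.gap_pos
  have he0 : 0 ≤ 1 / e := by positivity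
  have hn' : (0 : ℝ) < n := Nat.cast_pos.2 h.dim_pos
  have hsn : 0 < √(n : ℝ) := Real.sqrt_pos.2 hn'
  set R := (1 + K) / e with hR
  have hR0 : 0 < R := by positivity
  set τ := R * K + s with hτ
  have hτ0 : 0 ≤ τ := by positivity
  set η := C * Real.exp (-(s / (c * R)) ^ 2) with hη
  have hη0 : 0 ≤ η := mul_nonneg h.const_pos.le (Real.exp_pos _).le
  choose Di hDim hDind hDae using h.exists_indep
  -- the coefficient vectors, as functions of `(X₋ᵢ, Y₋ᵢ, D⁽ⁱ⁾)`
  set w : Fin p ⊕ Fin n →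
      Matrix (Fin p) (Fin n) ℝ × Matrix (Fin p) (Fin n) ℝ × (Fin n → ℝ) → Fin p → ℝ :=
    fun q z => Sum.elim (fun k => u k) (fun j => (√(n : ℝ))⁻¹ • z.2.1.col j) q ᵥ*
      dataResolvent z.1 (clipEntries κD z.2.2) z.2.1 with hw
  have hwm : ∀ q, Measurable (w q) := by
    intro q
    refine Measurable.vecMul ?_ (Measurable.dataResolvent measurable_fst ?_
      (measurable_fst.comp measurable_snd))
    · rcases q with k | j
      · exact measurable_const
      · refine measurable_pi_iff.2 fun a => measurable_const.mul ?_
        exact measurable_matrix_iff.1 (measurable_fst.comp measurable_snd) a j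
    · refine measurable_pi_iff.2 fun j => measurable_const.max (measurable_const.min ?_)
      exact measurable_pi_iff.1 (measurable_snd.comp measurable_snd) j
  set W : Fin n → Ω → Matrix (Fin p) (Fin n) ℝ × Matrix (Fin p) (Fin n) ℝ × (Fin n → ℝ) :=
    fun i ω => (dropCol (X ω) i, dropCol (Y ω) i, Di i ω) with hW
  have hdrop : ∀ {Z : Ω → Matrix (Fin p) (Fin n) ℝ}, Measurable Z → ∀ i,
      Measurable fun ω => dropCol (Z ω) i := by
    intro Z hZ i
    refine measurable_matrix_iff.2 fun a j => ?_
    by_cases hj : j = i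
    · simp [dropCol, hj]
    · simpa [dropCol, hj] using measurable_matrix_iff.1 hZ a j
  have hWm : ∀ i, Measurable (W i) := fun i =>
    (hdrop h.measurable_left i).prodMk ((hdrop h.measurable_right i).prodMk (hDim i))
  have hcolm : ∀ i, Measurable fun ω => (X ω).col i := fun i =>
    measurable_pi_iff.2 fun a => measurable_matrix_iff.1 h.measurable_left a i
  set B : (Fin p ⊕ Fin n) × Fin n → Set Ω := fun r =>
    {ω | euclNorm (w r.1 (W r.2 ω)) ≤ R ∧ τ ≤ |w r.1 (W r.2 ω) ⬝ᵥ (X ω).col r.2|} with hB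
  have hBle : ∀ r, μ.real (B r) ≤ η := fun r =>
    measureReal_le_of_indepFun (hWm r.2) (hcolm r.2) (hDind r.2) (hwm r.1) hη0
      fun a ha => h.conc.dotProduct_col_le (h.mean_le r.2) hR0 ha hs
  have hsub : {ω | (X ω, D ω, Y ω) ∉ directionalSet κ κD u
      ((1 + 1 / e) * (1 + K * K / e) * τ)} ≤ᵐ[μ] ⋃ r, B r := by
    filter_upwards [h.ae_bounded, ae_all_iff.2 hDae] with ω hz hDω
    intro hbad
    by_contra hcon
    refine hbad ⟨hz, fun k i => ?_⟩
    have hD0 := h.kappaD_nonneg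
    have hDj := (specNorm_diagonal_le_iff _ hD0).1 hz.diag
    have hclip : specNorm (Matrix.diagonal (clipEntries κD (Di i ω))) ≤ κD :=
      (specNorm_diagonal_le_iff _ hD0).2 (abs_clipEntries_le hD0 _)
    have hz₁ : SpecBounded κ κD (dropCol (X ω) i) (clipEntries κD (Di i ω)) (dropCol (Y ω) i) :=
      ⟨(specNorm_dropCol_le _ _).trans hz.left, (specNorm_dropCol_le _ _).trans hz.right, hclip⟩
    have hQ := (hz₁.isUnit_and_specNorm_le h.dim_pos h.kappa_nonneg he h.gap).2
    have hnot : ∀ q, euclNorm (w q (W i ω)) ≤ R → |w q (W i ω) ⬝ᵥ (X ω).col i| ≤ τ := by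
      intro q hq
      by_contra hlt
      exact hcon (Set.mem_iUnion.2 ⟨(q, i), hq, (not_le.1 hlt).le⟩)
    have hu' : |u k ⬝ᵥ dataResolvent (dropCol (X ω) i) (clipEntries κD (Di i ω))
        (dropCol (Y ω) i) *ᵥ (X ω).col i| ≤ τ := by
      have := hnot (Sum.inl k) ?_
      · rwa [hw, ← Matrix.dotProduct_mulVec] at this
      · refine (euclNorm_vecMul_le _ _).trans ?_
        refine (mul_le_mul (hu k) hQ (specNorm_nonneg _) zero_le_one).trans ?_
        rw [one_mul, hR]
        exact div_le_div_of_nonneg_right (by linarith) he.le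
    have hy' : ∀ j, |((dropCol (Y ω) i)ᵀ *ᵥ (dataResolvent (dropCol (X ω) i)
        (clipEntries κD (Di i ω)) (dropCol (Y ω) i) *ᵥ (X ω).col i)) j| ≤ √(n : ℝ) * τ := by
      intro j
      have := hnot (Sum.inr j) ?_
      · rw [hw, ← Matrix.dotProduct_mulVec] at this
        simp only [Sum.elim_inr] at this
        rw [smul_dotProduct, smul_eq_mul, abs_mul, abs_of_pos (inv_pos.2 hsn),
          inv_mul_le_iff₀ hsn] at this
        exact this
      · refine (euclNorm_vecMul_le _ _).trans ?_
        have h1 : euclNorm ((√(n : ℝ))⁻¹ • (dropCol (Y ω) i).col j) ≤ K := by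
          rw [euclNorm_smul, abs_of_pos (inv_pos.2 hsn), inv_mul_le_iff₀ hsn]
          exact (euclNorm_col_le_specNorm _ j).trans (hz₁.right.trans
            (mul_le_mul_of_nonneg_left h.kappa_le hsn.le))
        refine (mul_le_mul h1 hQ (specNorm_nonneg _) hK).trans ?_
        rw [hR, mul_one_div]
        exact div_le_div_of_nonneg_right (by linarith) he.le
    refine (abs_dotProduct_dataResolvent_col_le hz hclip h.dim_pos h.kappa_nonneg he h.gap (hu k) i
      ((euclNorm_dropEntry_sub_clipEntries_le hDj _ i).trans (hDω i)) hy').trans ?_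
    rw [mul_assoc]
    refine mul_le_mul_of_nonneg_left ?_ (by positivity)
    rw [add_mul, one_mul]
    refine add_le_add hu' (mul_le_mul_of_nonneg_right ?_ hτ0)
    exact div_le_div_of_nonneg_right (mul_le_mul_of_nonneg_left h.kappa_le hK) he.le
  calc _ ≤ μ.real (⋃ r, B r) := ENNReal.toReal_mono (measure_ne_top _ _) (measure_mono_ae hsub)
    _ ≤ ∑ r, μ.real (B r) := measureReal_iUnion_fintype_le _
    _ ≤ ∑ _r : (Fin p ⊕ Fin n) × Fin n, η := Finset.sum_le_sum fun r _ => hBle r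
    _ = (p + n) * n * η := by simp

/-- A threshold `m` for the numbers `uₖᵀ Q x_i`, in units of `T`. -/
noncomputable def directionalBound (c K e : ℝ) : ℝ :=
  (1 + 1 / e) * (1 + K * K / e) * ((1 + K) / e * (K + 2 * c))

lemma measureReal_notMem_directionalSet_le_exp
    (h : BoundedConcentratedTriple μ X D Y C c K e κ κD)
    {u : Fin p → Fin p → ℝ} (hu : ∀ k, euclNorm (u k) ≤ 1) {T : ℝ} (hT : 1 ≤ T)
    (hnT : Real.log n ≤ T ^ 2) :
    μ.real {ω | (X ω, D ω, Y ω) ∉ directionalSet κ κD u (directionalBound c K e * T)}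
      ≤ (K + 1) * C * Real.exp (-T ^ 2) := by
  have hK := h.bound_nonneg
  have he := h.gap_pos
  have hc := h.scale_pos
  have hC := h.const_pos
  have hn' : (0 : ℝ) < n := Nat.cast_pos.2 h.dim_pos
  have hR0 : 0 < (1 + K) / e := by positivity
  have hT0 : 0 < T := by linarith
  have hmono : {ω | (X ω, D ω, Y ω) ∉ directionalSet κ κD u (directionalBound c K e * T)}
      ⊆ {ω | (X ω, D ω, Y ω) ∉ directionalSet κ κD u ((1 + 1 / e) * (1 + K * K / e) *
        ((1 + K) / e * K + 2 * T * (c * ((1 + K) / e))))} := by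
    intro ω hω hmem
    refine hω ⟨hmem.1, fun k i => (hmem.2 k i).trans ?_⟩
    rw [directionalBound, mul_assoc _ _ T]
    refine mul_le_mul_of_nonneg_left ?_ (by positivity)
    have : (1 + K) / e * K ≤ (1 + K) / e * K * T :=
      le_mul_of_one_le_right (by positivity) hT
    linarith
  -- the deviation is chosen to give the tail `exp (-4 T²)`, which absorbs `n² ≤ exp (2 T²)`
  refine (measureReal_mono hmono).trans
    ((h.measureReal_notMem_directionalSet_le hu (by positivity)).trans ?_)
  rw [mul_div_assoc, div_self (by positivity), mul_one]
  have h1 : ((p : ℝ) + n) * n ≤ (K + 1) * (n : ℝ) ^ 2 := by nlinarith [h.dim_le]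
  have h2 : (n : ℝ) ^ 2 ≤ Real.exp (2 * T ^ 2) := by
    rw [← Real.exp_log hn', ← Real.exp_nat_mul]
    exact Real.exp_le_exp.2 (by push_cast; linarith)
  have h3 : Real.exp (2 * T ^ 2) * Real.exp (-(2 * T) ^ 2) ≤ Real.exp (-T ^ 2) := by
    rw [← Real.exp_add]
    exact Real.exp_le_exp.2 (by nlinarith)
  calc ((p : ℝ) + n) * n * (C * Real.exp (-(2 * T) ^ 2))
      ≤ (K + 1) * Real.exp (2 * T ^ 2) * (C * Real.exp (-(2 * T) ^ 2)) :=
        mul_le_mul_of_nonneg_right (h1.trans (mul_le_mul_of_nonneg_left h2 (by linarith)))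
          (mul_nonneg hC.le (Real.exp_pos _).le)
    _ = (K + 1) * C * (Real.exp (2 * T ^ 2) * Real.exp (-(2 * T) ^ 2)) := by ring
    _ ≤ (K + 1) * C * Real.exp (-T ^ 2) := mul_le_mul_of_nonneg_left h3 (by positivity)

/-- The Lipschitz constant of the observations of `Q` on `directionalSet`, in units of `T / √n`. -/
noncomputable def lipschitzBound (c K e : ℝ) : ℝ :=
  2 * K * K / e ^ 2 + directionalBound c K e * K / e + 1

lemma abs_linearForm_dataResolvent_le (hn : 0 < n) (hκ : 0 ≤ κ) (he : 0 < e)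
    (hκe : κ ^ 2 * κD ≤ 1 - e) {f : Matrix (Fin p) (Fin p) ℝ →ₗ[ℝ] ℝ}
    (hf : ∀ A, |f A| ≤ specNorm A) {A B : Matrix (Fin p) (Fin n) ℝ} {d : Fin n → ℝ}
    (hz : SpecBounded κ κD A d B) : |f (dataResolvent A d B)| ≤ 1 / e :=
  (hf _).trans (hz.isUnit_and_specNorm_le hn hκ he hκe).2

lemma integrable_dataResolvent_apply (h : BoundedConcentratedTriple μ X D Y C c K e κ κD)
    (i j : Fin p) : Integrable (fun ω => dataResolvent (X ω) (D ω) (Y ω) i j) μ := by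
  have hm := measurable_matrix_iff.1
    (Measurable.dataResolvent h.measurable_left h.measurable_diag h.measurable_right) i j
  refine Integrable.of_bound hm.aestronglyMeasurable (1 / e) ?_
  filter_upwards [h.ae_bounded] with ω hz
  refine le_trans ?_ (hz.isUnit_and_specNorm_le h.dim_pos h.kappa_nonneg h.gap_pos h.gap).2
  exact (abs_apply_le_euclNorm (Matrix.col _ j) i).trans (euclNorm_col_le_specNorm _ j)

/-- Deviations of `f(Q)` from `f(𝔼 Q)`, with a free truncation level `T`. -/
theorem measureReal_abs_linearForm_sub_le (h : BoundedConcentratedTriple μ X D Y C c K e κ κD)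
    {f : Matrix (Fin p) (Fin p) ℝ →ₗ[ℝ] ℝ} (hf : ∀ A, |f A| ≤ specNorm A) {s T : ℝ} (hs : 0 < s)
    (hT : 1 ≤ T) (hnT : Real.log n ≤ T ^ 2)
    (hsT : 4 / e * ((K + 1) * C) * Real.exp (-T ^ 2) ≤ s) :
    μ.real {ω | s ≤ |f (dataResolvent (X ω) (D ω) (Y ω)) -
        f (Matrix.of fun i j => ∫ ω', dataResolvent (X ω') (D ω') (Y ω') i j ∂μ)|}
      ≤ (K + 1) * C * Real.exp (-T ^ 2)
        + C * Real.exp (-(s * √(n : ℝ) / (2 * c * lipschitzBound c K e * T)) ^ 2) := by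
  have hK := h.bound_nonneg
  have he := h.gap_pos
  have hc := h.scale_pos
  have hn' : (0 : ℝ) < n := Nat.cast_pos.2 h.dim_pos
  have hsn : 0 < √(n : ℝ) := Real.sqrt_pos.2 hn'
  have hT0 : 0 < T := by linarith
  have hB0 : 0 ≤ directionalBound c K e := by unfold directionalBound; positivity
  have hL0 : 0 < lipschitzBound c K e := by unfold lipschitzBound; positivity
  obtain ⟨w, u, v, hw, hw1, hu, hv, hfuv⟩ := exists_rankOne_decomposition f hf
  set F : Triple p n → ℝ := fun z => f (dataResolvent z.1 z.2.1 z.2.2) with hF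
  have hFsum : (fun ω => F (X ω, D ω, Y ω)) = fun ω => ∑ i, ∑ j,
      dataResolvent (X ω) (D ω) (Y ω) i j * f (Matrix.single i j 1) :=
    funext fun ω => linearForm_eq_dotProduct_sum f _
  have hmean : f (Matrix.of fun i j => ∫ ω', dataResolvent (X ω') (D ω') (Y ω') i j ∂μ)
      = ∫ ω', F (X ω', D ω', Y ω') ∂μ := by
    rw [hFsum, linearForm_eq_dotProduct_sum f,
      integral_finsetSum _ fun i _ => integrable_finsetSum _ fun j _ =>
      (h.integrable_dataResolvent_apply i j).mul_const _]
    refine Finset.sum_congr rfl fun i _ => ?_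
    rw [integral_finsetSum _ fun j _ => (h.integrable_dataResolvent_apply i j).mul_const _]
    exact Finset.sum_congr rfl fun j _ => by rw [integral_mul_const]; rfl
  have hFi : Integrable (fun ω => F (X ω, D ω, Y ω)) μ := by
    rw [hFsum]
    exact integrable_finsetSum _ fun i _ => integrable_finsetSum _ fun j _ =>
      (h.integrable_dataResolvent_apply i j).mul_const _
  have hLip : ∀ z ∈ directionalSet κ κD u (directionalBound c K e * T),
      ∀ z' ∈ directionalSet (n := n) κ κD u (directionalBound c K e * T),
      |F z - F z'| ≤ lipschitzBound c K e * T / √(n : ℝ) * tripleNorm (z - z') := by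
    intro z hz z' hz'
    have hN0 : 0 ≤ tripleNorm (z - z') := (frobNorm_nonneg _).trans (le_max_left _ _)
    set ℓ := lipschitzBound c K e * T / √(n : ℝ) * tripleNorm (z - z') with hℓ
    have hℓ0 : 0 ≤ ℓ := by positivity
    have hone : ∀ k, |u k ⬝ᵥ (dataResolvent z.1 z.2.1 z.2.2
        - dataResolvent z'.1 z'.2.1 z'.2.2) *ᵥ v k| ≤ ℓ := by
      intro k
      refine (abs_dotProduct_dataResolvent_sub_le hz.1 hz'.1 h.dim_pos h.kappa_nonneg he h.gap
        (hu k) (hv k) (by positivity) (hz.2 k)).trans ?_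
      refine mul_le_mul_of_nonneg_right (div_le_div_of_nonneg_right ?_ hsn.le) hN0
      have h1 : 2 * κ * κD / e ^ 2 ≤ 2 * K * K / e ^ 2 * T := by
        refine le_trans (div_le_div_of_nonneg_right ?_ (by positivity))
          (le_mul_of_one_le_right (by positivity) hT)
        exact mul_le_mul (by linarith [h.kappa_le]) h.kappaD_le h.kappaD_nonneg (by positivity)
      have h2 : directionalBound c K e * T * κ / e ≤ directionalBound c K e * K / e * T := by
        have := mul_le_mul_of_nonneg_left h.kappa_le (show 0 ≤ directionalBound c K e * T / e by
          positivity)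
        calc _ = directionalBound c K e * T / e * κ := by ring
          _ ≤ _ := this
          _ = _ := by ring
      unfold lipschitzBound
      linarith
    have hdiff : F z - F z' = ∑ k, w k * (u k ⬝ᵥ (dataResolvent z.1 z.2.1 z.2.2
        - dataResolvent z'.1 z'.2.1 z'.2.2) *ᵥ v k) := by
      simp only [hF]
      rw [← map_sub, hfuv]
    rw [hdiff]
    calc _ ≤ ∑ k, |w k * (u k ⬝ᵥ (dataResolvent z.1 z.2.1 z.2.2
        - dataResolvent z'.1 z'.2.1 z'.2.2) *ᵥ v k)| := Finset.abs_sum_le_sum_abs _ _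
      _ ≤ ∑ k, w k * ℓ := by
          refine Finset.sum_le_sum fun k _ => ?_
          rw [abs_mul, abs_of_nonneg (hw k)]
          exact mul_le_mul_of_nonneg_left (hone k) (hw k)
      _ = (∑ k, w k) * ℓ := by rw [Finset.sum_mul]
      _ ≤ ℓ := mul_le_of_le_one_left hℓ0 hw1
  have key := h.conc.of_lipschitzOn tripleNorm_zero tripleNorm_neg tripleNorm_add_le
    (show 0 < lipschitzBound c K e * T / √(n : ℝ) by positivity) hLip (M := 1 / e)
    (fun z hz => abs_linearForm_dataResolvent_le h.dim_pos h.kappa_nonneg he h.gap hf hz.1)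
    (by
      filter_upwards [h.ae_bounded] with ω hz
      exact abs_linearForm_dataResolvent_le h.dim_pos h.kappa_nonneg he h.gap hf hz)
    hFi (h.measureReal_notMem_directionalSet_le_exp hu hT hnT) hs
    (by
      have : 2 * (1 / e) * ((K + 1) * C * Real.exp (-T ^ 2))
          = 4 / e * ((K + 1) * C) * Real.exp (-T ^ 2) / 2 := by ring
      rw [this]; linarith)
  rw [hmean]
  refine key.trans (le_of_eq ?_)
  congr 5
  field_simp

end BoundedConcentratedTriple

/-! ### Optimization of the truncation level -/

/-- Optimization of the truncation level: with `x = s √n`, the choice `T² = max (x, log n)` turns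
the tail bounds below into the sum of the two required profiles. -/
lemma le_profile_of_truncated_tail {n : ℕ} (hn : 0 < n) {C C₃ a b P s : ℝ} (hC : 0 ≤ C)
    (hC₃ : 0 ≤ C₃) (ha : 0 ≤ a) (hb : 0 < b) (hs : 0 < s) (hP1 : P ≤ 1)
    (hP : ∀ T : ℝ, 1 ≤ T → Real.log n ≤ T ^ 2 → a * Real.exp (-T ^ 2) ≤ s →
      P ≤ C₃ * Real.exp (-T ^ 2) + C * Real.exp (-(s * √(n : ℝ) / (b * T)) ^ 2)) :
    P ≤ (C₃ + Real.exp 1 * C + Real.exp √(1 + a)) *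
      ((if √(Real.log n / n) = 0 then 0
          else Real.exp (-(s / (1 + b + b ^ 4) / √(Real.log n / n)))) +
        Real.exp (-√(s / (1 + b + b ^ 4) / (1 / √(n : ℝ))))) := by
  have hn' : (0 : ℝ) < n := Nat.cast_pos.2 hn
  have hn1 : (1 : ℝ) ≤ n := Nat.one_le_cast.2 hn
  have hsn : 0 < √(n : ℝ) := Real.sqrt_pos.2 hn'
  have hlog : 0 ≤ Real.log n := Real.log_nonneg hn1
  set d := 1 + b + b ^ 4 with hd
  have hb4 : 0 < b ^ 4 := by positivity
  have hd1 : 1 ≤ d := by rw [hd]; linarith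
  have hd0 : 0 < d := by linarith
  set x := s * √(n : ℝ) with hx
  have hx0 : 0 < x := by positivity
  have hxd : s / d / (1 / √(n : ℝ)) = x / d := by rw [hx]; field_simp
  rw [hxd]
  clear_value x d
  set α := (if √(Real.log n / n) = 0 then (0 : ℝ)
    else Real.exp (-(s / d / √(Real.log n / n)))) with hα
  have hα0 : 0 ≤ α := by rw [hα]; split_ifs; exacts [le_rfl, (Real.exp_pos _).le]
  set β := Real.exp (-√(x / d)) with hβ
  have hβ0 : 0 < β := Real.exp_pos _
  have he1 : 1 ≤ Real.exp 1 := Real.one_le_exp zero_le_one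
  have hCe : C ≤ Real.exp 1 * C := le_mul_of_one_le_left hC he1
  have hexp : 0 < Real.exp √(1 + a) := Real.exp_pos _
  -- it suffices to bound `P` by these three contributions
  suffices hsuff : P ≤ C₃ * β + Real.exp 1 * C * (α + β) + Real.exp √(1 + a) * β from
    hsuff.trans (by nlinarith [mul_nonneg hC₃ hα0, mul_nonneg hexp.le hα0])
  have hCe0 : 0 ≤ Real.exp 1 * C := hC.trans hCe
  rcases lt_or_ge x (1 + a) with hxa | hxa
  · -- small deviations: the bound is trivial
    have h1 : 1 ≤ Real.exp √(1 + a) * β := by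
      rw [hβ, ← Real.exp_add]
      refine Real.one_le_exp ?_
      have : √(x / d) ≤ √(1 + a) :=
        Real.sqrt_le_sqrt ((div_le_self hx0.le hd1).trans hxa.le)
      linarith
    have h2 : 0 ≤ C₃ * β := mul_nonneg hC₃ hβ0.le
    have h3 : 0 ≤ Real.exp 1 * C * (α + β) := mul_nonneg hCe0 (add_nonneg hα0 hβ0.le)
    linarith
  · have hx1 : 1 ≤ x := by linarith
    have hbase : ∀ T : ℝ, Real.log n ≤ T ^ 2 → a * Real.exp (-T ^ 2) ≤ s := by
      intro T hT
      have h1 : Real.exp (-T ^ 2) ≤ (n : ℝ)⁻¹ := by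
        rw [Real.exp_neg]
        exact inv_anti₀ hn' ((Real.log_le_iff_le_exp hn').1 hT)
      have h2 : (n : ℝ)⁻¹ ≤ (√(n : ℝ))⁻¹ := by
        refine inv_anti₀ hsn ?_
        rw [Real.sqrt_le_left hn'.le]; nlinarith
      calc a * Real.exp (-T ^ 2) ≤ x * (√(n : ℝ))⁻¹ :=
            mul_le_mul (by linarith) (h1.trans h2) (Real.exp_pos _).le hx0.le
        _ = s := by rw [hx]; field_simp
    have hsx : √(x / d) ≤ x := by
      rw [Real.sqrt_le_left hx0.le]
      exact (div_le_self hx0.le hd1).trans (by nlinarith)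
    have hexpx : Real.exp (-x) ≤ β := Real.exp_le_exp.2 (by linarith)
    have hlast : 0 ≤ Real.exp √(1 + a) * β := by positivity
    rcases le_or_gt (Real.log n) x with hlx | hlx
    · have hT2 : √x ^ 2 = x := Real.sq_sqrt hx0.le
      have h1 := hP √x (Real.one_le_sqrt.2 hx1) (by rwa [hT2]) (hbase _ (by rwa [hT2]))
      rw [hT2] at h1
      have h2 : (x / (b * √x)) ^ 2 = x / b ^ 2 := by
        rw [div_pow, mul_pow b, hT2]; field_simp
      rw [h2] at h1
      have h3 : √(x / d) ≤ x / b ^ 2 := by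
        rw [Real.sqrt_le_left (by positivity), div_pow, ← pow_mul]
        refine div_le_div₀ (by positivity) (by nlinarith) (by positivity) ?_
        change b ^ 4 ≤ d
        rw [hd]; linarith
      have h4 : Real.exp (-(x / b ^ 2)) ≤ β := Real.exp_le_exp.2 (by linarith)
      have h5 : C₃ * Real.exp (-x) ≤ C₃ * β := mul_le_mul_of_nonneg_left hexpx hC₃
      have h6 : C * Real.exp (-(x / b ^ 2)) ≤ Real.exp 1 * C * (α + β) :=
        mul_le_mul hCe (by linarith) (Real.exp_pos _).le hCe0
      linarith
    · have hl0 : 0 < Real.log n := hx0.trans hlx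
      have hT2 : √(Real.log n) ^ 2 = Real.log n := Real.sq_sqrt hlog
      have hsl : 0 < √(Real.log n) := Real.sqrt_pos.2 hl0
      have h1 := hP √(Real.log n) (Real.one_le_sqrt.2 (by linarith)) hT2.ge (hbase _ hT2.ge)
      rw [hT2] at h1
      have hne : √(Real.log n / n) ≠ 0 := (Real.sqrt_pos.2 (by positivity)).ne'
      have hαe : α = Real.exp (-(x / √(Real.log n) / d)) := by
        rw [hα, if_neg hne, Real.sqrt_div hlog]
        congr 2
        rw [hx]; field_simp
      have h2 : x / √(Real.log n) / d ≤ x / (b * √(Real.log n)) := by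
        rw [div_div, mul_comm _ d]
        refine div_le_div_of_nonneg_left hx0.le (by positivity)
          (mul_le_mul_of_nonneg_right ?_ hsl.le)
        rw [hd]; linarith
      have h3 : Real.exp (-(x / (b * √(Real.log n))) ^ 2) ≤ Real.exp 1 * α := by
        rw [hαe, ← Real.exp_add]
        refine Real.exp_le_exp.2 ?_
        nlinarith [sq_nonneg (x / (b * √(Real.log n)) - 1 / 2)]
      have h4 : Real.exp (-Real.log n) ≤ β := (Real.exp_le_exp.2 (by linarith)).trans hexpx
      have h5 : C₃ * Real.exp (-Real.log n) ≤ C₃ * β := mul_le_mul_of_nonneg_left h4 hC₃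
      have h6 : C * Real.exp (-(x / (b * √(Real.log n))) ^ 2) ≤ Real.exp 1 * C * (α + β) := by
        calc _ ≤ C * (Real.exp 1 * α) := mul_le_mul_of_nonneg_left h3 hC
          _ = Real.exp 1 * C * α := by ring
          _ ≤ _ := mul_le_mul_of_nonneg_left (by linarith) hCe0
      linarith

theorem mainTheorem9
    {Θ : Type*} (n p : Θ → ℕ) (hn : ∀ t, 0 < n t)
    {Ω : Θ → Type*} [∀ t, MeasurableSpace (Ω t)]
    (μ : ∀ t, Measure (Ω t)) [∀ t, IsProbabilityMeasure (μ t)]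
    (X Y : ∀ t, Ω t → Matrix (Fin (p t)) (Fin (n t)) ℝ)
    (D : ∀ t, Ω t → Fin (n t) → ℝ)
    (hX : ∀ t, Measurable (X t)) (hY : ∀ t, Measurable (Y t)) (hD : ∀ t, Measurable (D t))
    -- the regime `p ≤ O(n)`
    (hpn : LeO (fun t => (p t : ℝ)) (fun t => (n t : ℝ)))
    -- `(X, D, Y) ∝ 𝓔₂`
    (hconc : LipschitzConcentrated μ (fun t => tripleNorm (p := p t) (n := n t))
      (fun t ω => (X t ω, D t ω, Y t ω)) (expProfile 2 (fun _ => 1)))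
    -- the couples `(x_i, y_i)` are independent
    (hindep : ∀ t, iIndepFun (fun (i : Fin (n t)) ω => ((X t ω).col i, (Y t ω).col i)) (μ t))
    -- the expectations of the columns are bounded
    (hmean : ∃ K : ℝ, ∀ t (i : Fin (n t)),
      ‖WithLp.toLp 2 (fun k => ∫ ω, X t ω k i ∂(μ t))‖ ≤ K ∧
      ‖WithLp.toLp 2 (fun k => ∫ ω, Y t ω k i ∂(μ t))‖ ≤ K)
    -- `D⁽ⁱ⁾` close to `D` such that `(x_i, y_i)` is independent of `D⁽ⁱ⁾` and the other columns
    (hDi : ∃ K : ℝ, ∀ t (i : Fin (n t)), ∃ Di : Ω t → Fin (n t) → ℝ, Measurable Di ∧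
      IndepFun (fun ω => (dropCol (X t ω) i, dropCol (Y t ω) i, Di ω))
        (fun ω => ((X t ω).col i, (Y t ω).col i)) (μ t) ∧
      ∀ᵐ ω ∂(μ t),
        frobNorm (Matrix.diagonal (dropEntry (D t ω) i - dropEntry (Di ω) i)) ≤ K)
    -- the boundedness assumptions
    (κ κD ε : Θ → ℝ) (hκ : ∀ t, 0 < κ t) (hκD : ∀ t, 0 < κD t)
    (hκO : LeO κ (fun _ => 1)) (hκDO : LeO κD (fun _ => 1)) (hεO : GeO ε (fun _ => 1))
    (hXbd : ∀ t, ∀ᵐ ω ∂(μ t), specNorm (X t ω) ≤ √(n t : ℝ) * κ t)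
    (hYbd : ∀ t, ∀ᵐ ω ∂(μ t), specNorm (Y t ω) ≤ √(n t : ℝ) * κ t)
    (hDbd : ∀ t, ∀ᵐ ω ∂(μ t), specNorm (Matrix.diagonal (D t ω)) ≤ κD t)
    (hκε : ∀ t, κ t ^ 2 * κD t ≤ 1 - ε t) :
    (∀ t, ∀ᵐ ω ∂(μ t), IsUnit (resolventInv (X t ω) (D t ω) (Y t ω))) ∧
    LinearlyConcentrated μ (fun t => specNorm (m := p t) (n := p t))
      (fun t ω => dataResolvent (X t ω) (D t ω) (Y t ω))
      (expProfile 1 (fun t => √(Real.log (n t) / n t)) +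
        expProfile (1 / 2) (fun t => 1 / √(n t : ℝ))) := by

  obtain ⟨C, c, hC, hc, hconc⟩ := hconc
  obtain ⟨P, -, hP⟩ := hpn
  obtain ⟨K₁, hK₁⟩ := hmean
  obtain ⟨K₂, hK₂⟩ := hDi
  obtain ⟨Cκ, hCκ, hκO⟩ := hκO
  obtain ⟨CD, hCD, hκDO⟩ := hκDO
  obtain ⟨e, he, hε⟩ := hεO
  simp only [mul_one] at hκO hκDO hε
  set K : ℝ := |P| + |K₁| + |K₂| + Cκ + CD with hK
  have hPa := le_abs_self P
  have hK₁a := le_abs_self K₁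
  have hK₂a := le_abs_self K₂
  have hP0 := abs_nonneg P
  have hK₁0 := abs_nonneg K₁
  have hK₂0 := abs_nonneg K₂
  have hset : ∀ t, BoundedConcentratedTriple (μ t) (X t) (D t) (Y t) C c K e (κ t) (κD t) := by
    intro t
    refine
      { measurable_left := hX t
        measurable_right := hY t
        measurable_diag := hD t
        dim_pos := hn t
        dim_le := (hP t).trans (mul_le_mul_of_nonneg_right (by linarith) (Nat.cast_nonneg _))
        const_pos := hC
        scale_pos := hc
        bound_nonneg := by positivity
        gap_pos := he
        conc := fun f hf => ?_
        mean_le := fun i => (hK₁ t i).1.trans (by linarith)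
        exists_indep := fun i => ?_
        kappa_nonneg := (hκ t).le
        kappa_le := (hκO t).trans (by linarith)
        kappaD_nonneg := (hκD t).le
        kappaD_le := (hκDO t).trans (by linarith)
        ae_bounded := by
          filter_upwards [hXbd t, hYbd t, hDbd t] with ω h1 h2 h3 using ⟨h1, h2, h3⟩
        gap := (hκε t).trans (by linarith [hε t]) }
    · obtain ⟨h1, h2⟩ := hconc t f hf
      refine ⟨h1, fun s hs => (h2 s hs).trans (le_of_eq ?_)⟩
      simp [expProfile]
    · obtain ⟨Di, hDm, hind, hae⟩ := hK₂ t i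
      refine ⟨Di, hDm, hind.comp measurable_id measurable_fst, ?_⟩
      filter_upwards [hae] with ω hω
      rw [frobNorm_diagonal] at hω
      exact hω.trans (by linarith)
  have hK0 : 0 ≤ K := by positivity
  refine ⟨fun t => ?_, fun t => Matrix.of fun i j =>
    ∫ ω, dataResolvent (X t ω) (D t ω) (Y t ω) i j ∂(μ t), ?_⟩
  · filter_upwards [(hset t).ae_bounded] with ω hz
    exact (hz.isUnit_and_specNorm_le (hn t) (hκ t).le he (hset t).gap).1
  · have hB0 : 0 ≤ BoundedConcentratedTriple.directionalBound c K e := by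
      unfold BoundedConcentratedTriple.directionalBound; positivity
    have hL0 : 0 < BoundedConcentratedTriple.lipschitzBound c K e := by
      unfold BoundedConcentratedTriple.lipschitzBound; positivity
    set b := 2 * c * BoundedConcentratedTriple.lipschitzBound c K e with hb
    have hb0 : 0 < b := by positivity
    refine ⟨(K + 1) * C + Real.exp 1 * C + Real.exp √(1 + 4 / e * ((K + 1) * C)),
      1 + b + b ^ 4, by positivity, by positivity, fun t f hf s hs => ?_⟩
    refine (le_profile_of_truncated_tail (hn t) hC.le (by positivity) (by positivity) hb0 hs
      measureReal_le_one fun T hT hnT hsT =>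
        (hset t).measureReal_abs_linearForm_sub_le hf hs hT hnT hsT).trans (le_of_eq ?_)
    have hne : 1 / √(n t : ℝ) ≠ 0 :=
      (one_div_pos.2 (Real.sqrt_pos.2 (Nat.cast_pos.2 (hn t)))).ne'
    simp only [Pi.add_apply, expProfile, Real.rpow_one, if_neg hne, Real.sqrt_eq_rpow (_ / (1 / _))]
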